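/- **Model.** A rational-valued two-way automaton with deterministic and affine states (2ADfA) has a finite set of deterministic states, some accepting and some rejecting, a two-way read-only head on the tape $\text{¢}\,w\,\$$ which it never leaves, and $k\ge 1$ affine registers. A register with a finite basis $E$ holds a vector $v\in\mathbb{Q}^{E}$ with entry sum $1$ and starts in a fixed basis vector. In each step, depending on the deterministic state and the scanned symbol, each register is either multiplied by a rational matrix all of whose columns sum to $1$, or weighted: the basis state $j$ is observed with probability $|v_j|/\|v\|_1$, and the register collapses to $e_j$. The new deterministic state and the head move (by $-1$, $0$ or $+1$) are determined by the state, the scanned symbol and the observed outcomes. The computation halts as soon as it enters an accepting or a rejecting state. As a verifier, the automaton also has communication states, with a finite communication alphabet $\Gamma$: on entering such a state it writes a symbol determined by the state; the prover answers with a symbol of $\Gamma$; and the next deterministic state is determined by the current state and the answer. In the Arthur–Merlin (public-coin) setting, a prover is an arbitrary function giving each answer from the input and the complete history of deterministic states, head moves, weighting outcomes and messages. **Language.** Consider words $$w=S\,\forall(a_1,b_1)\,\exists(e_1,f_1)\cdots\forall(a_n,b_n)\,\exists(e_n,f_n),\qquad n\ge 0,$$ where $S$ and all $a_i,b_i,e_i,f_i$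 are natural numbers given by non-empty binary numerals (leading zeros allowed, most significant bit first). Let $L_{KG}$ be the set of all such words for which $$\forall x_1\in\{a_1,b_1\}\ \exists y_1\in\{e_1,f_1\}\cdots\forall x_n\in\{a_n,b_n\}\ \exists y_n\in\{e_n,f_n\}:\quad S=\sum_{i=1}^n(x_i+y_i),$$ and let $L'_{KG}$ be the set of all such words for which for every $x\in\prod_{i=1}^n\{a_i,b_i\}$ there is $y\in\prod_{i=1}^n\{e_i,f_i\}$ with $S=\sum_{i=1}^n(x_i+y_i)$. **Theorem.** Let $0<\epsilon<1/2$, and let $L$ be either of the two forms $L_{KG}$, $L'_{KG}$ of the Knapsack-game language. There is a rational-valued 2ADfA $V$ that verifies $L$ in the Arthur–Merlin setting with error $\epsilon$ and perfect completeness. That is, there is a prover $P$ such that for every $w\in L$ the pair $(P,V)$ accepts $w$ with probability $1$; and for every $w\notin L$ and every prover $P^*$, the pair $(P^*,V)$ rejects $w$ with probability at least $1-\epsilon$. -/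

import Mathlib

/-! ### Arthur-Merlin verifiers that are two-way automata with deterministic and affine states -/

/-- The symbols on the tape: the input symbols and the two end-markers. -/
inductive TapeSymbol (α : Type) where
  | leftEnd
  | sym (a : α)
  | rightEnd

/-- Head moves: one cell to the left, no move, one cell to the right. -/
inductive HeadMove where
  | left
  | stay
  | right

/-- The new head position. A verifier (see below) never moves left on cell `0`,
so the subtraction is never truncated. -/
def HeadMove.apply : HeadMove → ℕ → ℕ
  | .left, j => j - 1
  | .stay, j => j
  | .right, j => j + 1

/-- The symbol in cell `j` of the tape `¢ w $`, whose cells are numbered `0, …, |w| + 1`. -/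
def tapeAt {α : Type} (w : List α) : ℕ → TapeSymbol α
  | 0 => .leftEnd
  | j + 1 => match w[j]? with
    | some a => .sym a
    | none => .rightEnd

/-- The deterministic states of a verifier are of four kinds: ordinary working states,
communication states (with the symbol that is written to the communication cell when the state is
entered), accepting states (`halt true`) and rejecting states (`halt false`). -/
inductive StateKind (Γ : Type) where
  | work
  | com (written : Γ)
  | halt (accepting : Bool)

/-- A rational affine operator: a rational square matrix whose columns sum to one. -/
def AffineOperator (E : Type) [Fintype E] : Type :=
  {A : Matrix E E ℚ // ∀ j, ∑ i, A i j = 1}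

/-- What may be done to an affine register in one step: apply an affine operator, or weight it. -/
inductive RegisterOp (E : Type) [Fintype E] where
  | apply (A : AffineOperator E)
  | weight

/-- A two-way automaton with deterministic and affine states and rational entries, equipped with a
communication cell, over the (finite) input alphabet `α`. As there are finitely many states and
tape symbols, only finitely many affine operators occur. -/
structure AffineVerifier (α : Type) where
  /-- deterministic states -/
  State : Type
  /-- communication alphabet -/
  Γ : Type
  /-- names of the affine registers -/
  Reg : Type
  /-- basis states of each register -/
  Basis : Reg → Type
  [fintypeState : Fintype State]
  [fintypeΓ : Fintype Γ]
  [nonemptyΓ : Nonempty Γ]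
  [fintypeReg : Fintype Reg]
  [decEqReg : DecidableEq Reg]
  [nonemptyReg : Nonempty Reg]
  [fintypeBasis : ∀ i, Fintype (Basis i)]
  [decEqBasis : ∀ i, DecidableEq (Basis i)]
  /-- initial deterministic state -/
  start : State
  /-- initial basis state of each register -/
  startBasis : ∀ i, Basis i
  kind : State → StateKind Γ
  /-- affine part of the transition function -/
  affinePart : State → TapeSymbol α → ∀ i, RegisterOp (Basis i)
  /-- deterministic part of the transition function; it sees the outcome of every register that
  has just been weighted, and `none` for every other register -/
  detPart : State → TapeSymbol α → (∀ i, Option (Basis i)) → State × HeadMove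
  /-- new deterministic state after a reply of the prover in a communication state -/
  onReply : State → Γ → State
  /-- the head never leaves the tape on the left -/
  no_exit_left : ∀ s τ, (detPart s .leftEnd τ).2 ≠ .left
  /-- the head never leaves the tape on the right -/
  no_exit_right : ∀ s τ, (detPart s .rightEnd τ).2 ≠ .right

namespace AffineVerifier

attribute [instance] fintypeState fintypeΓ nonemptyΓ fintypeReg decEqReg nonemptyReg
  fintypeBasis decEqBasis

variable {α : Type} (V : AffineVerifier α)

/-- A configuration: deterministic state, head position, contents of the affine registers. -/
structure Config where
  state : V.State
  head : ℕ
  reg : ∀ i, V.Basis i → ℚ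

/-- The initial configuration. -/
def initial : V.Config where
  state := V.start
  head := 0
  reg i := Pi.single (V.startBasis i) 1

/-- The weighting outcomes of one step; `none` for registers that are not weighted. -/
abbrev Outcome : Type := ∀ i, Option (V.Basis i)

/-- What becomes public in one step. An ordinary step reveals the new deterministic state, the head
move and the weighting outcomes; a communication step reveals the written symbol, the reply and the
new deterministic state. -/
inductive Event where
  | step (state : V.State) (move : HeadMove) (outcome : V.Outcome)
  | message (written reply : V.Γ) (state : V.State)

/-- A prover chooses each reply from the input and the complete public history
(most recent event first). -/
abbrev Prover : Type := List α → List V.Event → V.Γ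

variable {V}

/-- The probability that a register with contents `v` yields the outcome `o` under an operation:
weighting yields the basis state `j` with probability `|v j| / ‖v‖₁`. -/
def outcomeProb {E : Type} [Fintype E] (v : E → ℚ) : RegisterOp E → Option E → ℚ
  | .apply _, none => 1
  | .apply _, some _ => 0
  | .weight, none => 0
  | .weight, some j => |v j| / ∑ i, |v i|

/-- The contents of a register after an operation with outcome `o`; weighting collapses the register
to the observed basis state. (The combination in the last line has probability zero.) -/
def updateReg {E : Type} [Fintype E] [DecidableEq E] (v : E → ℚ) :
    RegisterOp E → Option E → (E → ℚ)
  | .apply A, _ => A.1.mulVec v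
  | .weight, some j => Pi.single j 1
  | .weight, none => v

/-- The probability of the joint outcome `τ` of an ordinary step; the registers are weighted
independently. -/
def stepProb (w : List α) (c : V.Config) (τ : V.Outcome) : ℚ :=
  ∏ i, outcomeProb (c.reg i) (V.affinePart c.state (tapeAt w c.head) i) (τ i)

/-- The configuration after an ordinary step with joint outcome `τ`. -/
def stepConfig (w : List α) (c : V.Config) (τ : V.Outcome) : V.Config where
  state := (V.detPart c.state (tapeAt w c.head) τ).1
  head := (V.detPart c.state (tapeAt w c.head) τ).2.apply c.head
  reg i := updateReg (c.reg i) (V.affinePart c.state (tapeAt w c.head) i) (τ i)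

/-- The event published by an ordinary step with joint outcome `τ`. -/
def stepEvent (w : List α) (c : V.Config) (τ : V.Outcome) : V.Event :=
  .step (V.detPart c.state (tapeAt w c.head) τ).1 (V.detPart c.state (tapeAt w c.head) τ).2 τ

/-- The probability that the computation on `w` with the prover `P`, continued from the
configuration `c` with public history `h`, halts with the verdict `b` (`true`: acceptance, `false`:
rejection) within `n` steps: the total weight of the leaves with verdict `b` and depth at most `n`
in the tree of computations. -/
def haltWithin (P : V.Prover) (w : List α) (b : Bool) : ℕ → V.Config → List V.Event → ℚ
  | 0, c, _ => match V.kind c.state with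
    | .halt b' => if b' = b then 1 else 0
    | _ => 0
  | n + 1, c, h => match V.kind c.state with
    | .halt b' => if b' = b then 1 else 0
    | .com g =>
        haltWithin P w b n { c with state := V.onReply c.state (P w h) }
          (.message g (P w h) (V.onReply c.state (P w h)) :: h)
    | .work =>
        ∑ τ : V.Outcome, stepProb w c τ *
          haltWithin P w b n (stepConfig w c τ) (stepEvent w c τ :: h)

/-- Total probability that `(P, V)` halts on `w` with the verdict `b`. -/
noncomputable def haltProb (P : V.Prover) (w : List α) (b : Bool) : ℝ :=
  ⨆ n : ℕ, (haltWithin P w b n V.initial [] : ℝ)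

/-- Total probability that `(P, V)` accepts `w`. -/
noncomputable def Acc (P : V.Prover) (w : List α) : ℝ := haltProb P w true

/-- Total probability that `(P, V)` rejects `w`. -/
noncomputable def Rej (P : V.Prover) (w : List α) : ℝ := haltProb P w false

variable (V)

/-- `V` verifies `L` (in the strong sense: soundness asks for rejection, not just for
non-acceptance) with error `ε` and with perfect completeness, in the public-coin setting. -/
def VerifiesPerfectly (L : Set (List α)) (ε : ℝ) : Prop :=
  ∃ P : V.Prover,
    (∀ w ∈ L, Acc P w = 1) ∧
    (∀ w ∉ L, ∀ P' : V.Prover, 1 - ε ≤ Rej P' w)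

variable {V}

/-! The supremum in `haltProb` is that of a monotone sequence in `[0, 1]`. -/

theorem outcomeProb_nonneg {E : Type} [Fintype E] (v : E → ℚ) (r : RegisterOp E) (o : Option E) :
    0 ≤ outcomeProb v r o := by
  cases r <;> cases o <;> simp only [outcomeProb] <;> positivity

theorem sum_outcomeProb_le_one {E : Type} [Fintype E] (v : E → ℚ) (r : RegisterOp E) :
    ∑ o, outcomeProb v r o ≤ 1 := by
  cases r with
  | apply A => simp [Fintype.sum_option, outcomeProb]
  | weight =>
    simp only [Fintype.sum_option, outcomeProb, zero_add, ← Finset.sum_div]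
    exact div_self_le_one _

theorem stepProb_nonneg (w : List α) (c : V.Config) (τ : V.Outcome) : 0 ≤ stepProb w c τ :=
  Finset.prod_nonneg fun _ _ => outcomeProb_nonneg _ _ _

theorem sum_stepProb_le_one (w : List α) (c : V.Config) :
    ∑ τ : V.Outcome, stepProb w c τ ≤ 1 := by
  have h := Fintype.prod_sum (fun i (o : Option (V.Basis i)) =>
    outcomeProb (c.reg i) (V.affinePart c.state (tapeAt w c.head) i) o)
  unfold stepProb
  rw [← h]
  exact Finset.prod_le_one (fun i _ => Finset.sum_nonneg fun o _ => outcomeProb_nonneg _ _ _)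
    (fun i _ => sum_outcomeProb_le_one _ _)

theorem haltWithin_nonneg (P : V.Prover) (w : List α) (b : Bool) (n : ℕ) (c : V.Config)
    (h : List V.Event) : 0 ≤ haltWithin P w b n c h := by
  induction n generalizing c h with
  | zero => unfold haltWithin; split <;> (try split) <;> norm_num
  | succ n ih =>
    unfold haltWithin
    split
    · split <;> norm_num
    · exact ih _ _
    · exact Finset.sum_nonneg fun τ _ => mul_nonneg (stepProb_nonneg _ _ _) (ih _ _)

theorem haltWithin_mono (P : V.Prover) (w : List α) (b : Bool) (n : ℕ) (c : V.Config)
    (h : List V.Event) : haltWithin P w b n c h ≤ haltWithin P w b (n + 1) c h := by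
  induction n generalizing c h with
  | zero =>
    have h0 := haltWithin_nonneg P w b 1 c h
    revert h0
    unfold haltWithin
    cases V.kind c.state <;> simp
  | succ n ih =>
    rw [haltWithin, haltWithin]
    cases V.kind c.state with
    | halt b' => simp
    | com g => exact ih _ _
    | work => exact Finset.sum_le_sum fun τ _ =>
        mul_le_mul_of_nonneg_left (ih _ _) (stepProb_nonneg _ _ _)

theorem haltWithin_true_add_false_le_one (P : V.Prover) (w : List α) (n : ℕ) (c : V.Config)
    (h : List V.Event) : haltWithin P w true n c h + haltWithin P w false n c h ≤ 1 := by
  induction n generalizing c h with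
  | zero =>
    unfold haltWithin
    cases V.kind c.state with
    | halt b' => cases b' <;> simp
    | com g => simp
    | work => simp
  | succ n ih =>
    unfold haltWithin
    cases V.kind c.state with
    | halt b' => cases b' <;> simp
    | com g => exact ih _ _
    | work =>
      simp only [← Finset.sum_add_distrib, ← mul_add]
      refine le_trans (Finset.sum_le_sum fun τ _ => ?_) (sum_stepProb_le_one w c)
      exact mul_le_of_le_one_right (stepProb_nonneg _ _ _) (ih _ _)

theorem bddAbove_haltWithin (P : V.Prover) (w : List α) (b : Bool) :
    BddAbove (Set.range fun n : ℕ => (haltWithin P w b n V.initial [] : ℝ)) := by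
  refine ⟨1, ?_⟩
  rintro _ ⟨n, rfl⟩
  have h1 := haltWithin_true_add_false_le_one P w n V.initial []
  have h2 := haltWithin_nonneg P w true n V.initial []
  have h3 := haltWithin_nonneg P w false n V.initial []
  have h4 : haltWithin P w b n V.initial [] ≤ 1 := by cases b <;> linarith
  change ((haltWithin P w b n V.initial [] : ℚ) : ℝ) ≤ 1
  exact_mod_cast h4

end AffineVerifier

/-! ### The Knapsack game -/

/-- The input alphabet: the two binary digits, the two quantifiers, parentheses and the comma. -/
inductive KGSymbol where
  | bit (b : Bool)
  | all
  | ex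
  | lpar
  | comma
  | rpar
  deriving DecidableEq, Fintype

/-- The number with a given binary numeral, most significant bit first. -/
def binVal (l : List Bool) : ℕ := l.foldl (fun n b => 2 * n + b.toNat) 0

/-- One block `∀(a,b)∃(e,f)`, its four numbers being given by binary numerals. -/
structure KGBlock where
  a : List Bool
  b : List Bool
  e : List Bool
  f : List Bool

/-- The word `∀(a,b)∃(e,f)`. -/
def KGBlock.encode (B : KGBlock) : List KGSymbol :=
  [.all, .lpar] ++ B.a.map .bit ++ [.comma] ++ B.b.map .bit ++ [.rpar] ++
  [.ex, .lpar] ++ B.e.map .bit ++ [.comma] ++ B.f.map .bit ++ [.rpar]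

/-- The four numerals of the block are non-empty. -/
def KGBlock.WellFormed (B : KGBlock) : Prop := B.a ≠ [] ∧ B.b ≠ [] ∧ B.e ≠ [] ∧ B.f ≠ []

/-- The word `S ∀(a₁,b₁)∃(e₁,f₁) ⋯ ∀(aₙ,bₙ)∃(eₙ,fₙ)`. -/
def kgEncode (s : List Bool) (Bs : List KGBlock) : List KGSymbol :=
  s.map .bit ++ Bs.flatMap KGBlock.encode

/-- The alternating condition with the numbers chosen so far having the sum `t`:
for every `x₁ ∈ {a₁,b₁}` there is `y₁ ∈ {e₁,f₁}` such that for every `x₂ ∈ {a₂,b₂}` there is …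
such that `S = t + ∑ (xᵢ + yᵢ)`. -/
def kgAlternatingFrom (S : ℕ) : ℕ → List KGBlock → Prop
  | t, [] => S = t
  | t, B :: Bs => ∀ x ∈ ({binVal B.a, binVal B.b} : Set ℕ),
      ∃ y ∈ ({binVal B.e, binVal B.f} : Set ℕ), kgAlternatingFrom S (t + (x + y)) Bs

/-- The alternating (game) condition. -/
def kgAlternating (S : ℕ) (Bs : List KGBlock) : Prop := kgAlternatingFrom S 0 Bs

/-- The condition in which the whole sequence `x` is chosen before the whole sequence `y`. -/
def kgSequential (S : ℕ) (Bs : List KGBlock) : Prop :=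
  ∀ x : Fin Bs.length → ℕ, (∀ i, x i ∈ ({binVal (Bs.get i).a, binVal (Bs.get i).b} : Set ℕ)) →
    ∃ y : Fin Bs.length → ℕ, (∀ i, y i ∈ ({binVal (Bs.get i).e, binVal (Bs.get i).f} : Set ℕ)) ∧
      S = ∑ i, (x i + y i)

/-- The language of the well-formed words whose numbers satisfy the winning condition `win`. -/
def kgLanguage (win : ℕ → List KGBlock → Prop) : Set (List KGSymbol) :=
  {w | ∃ (s : List Bool) (Bs : List KGBlock),
    s ≠ [] ∧ (∀ B ∈ Bs, B.WellFormed) ∧ w = kgEncode s Bs ∧ win (binVal s) Bs}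

/-!
The verifier works in rounds. In a round it passes over the input, tossing a coin for each choice
of a universal number and asking the prover for each existential number, and accumulates in an
affine register the difference `t` of `S` and the sum of the chosen numbers. At the end the register
`(1, t, 0, -t)` is weighted: if `t ≠ 0`, the verifier rejects with probability at least `1 / 2`;
otherwise it accepts with an exponentially small probability, and else begins the next round.
-/

/-! One verifier, with a parameter `seq`, serves both forms of the game; a round reads the input
twice. For `seq = false` the first pass only reads `S`, while in the second one tosses and replies
alternate, so that a reply may depend on the tosses made so far. For `seq = true` all tosses are
made in the first pass and all replies in the second, when the whole sequence `x` is public.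
`CanWin` says that in a round the replies can force the difference to be `0` whatever the coin
shows. `setOf_canWin_eq` identifies the words with this property as the language: a malformed word
stops a pass, and on a well-formed word the quantifiers of the pass are those of the game.

Completeness: since everything is public, the prover knows the configuration and can stay in winning
positions (`haltWithin_keepProver_false`), where the test at the end of a round never fails. From
every configuration satisfying the invariant, the computation halts within `6 * n + 6` steps with
probability at least `δ ^ (n + 1)`, where `n` is the length of the input (`le_haltSum_verifier`).
Hence it halts almost surely, and without rejection it must accept.

Soundness: if the prover cannot win, then in each round the tosses, at most `2 * n` of them, defeat
it with probability at least `2 ^ (-2 * n)`. After that, either the pass breaks off or a nonzero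
integer vector is tested, so rejection has probability at least `1 / 2`. A round thus rejects with
probability at least `2 ^ (-(2 * n + 1))`, whereas it accepts with probability at most `δ ^ (n +
1)`; for `δ = ε / 4` the latter is small enough in comparison. The rounds are summed up by a
supermartingale, `potential`, through `haltWithin_true_le`, and `bound_restart_le` is the inequality
that lets a round begin again at the value `ε`. As halting is almost sure, a bound on acceptance is
also one on rejection. -/

namespace AffineVerifier

/-! ### Affine registers and expectations over the outcomes of a step -/

variable {α : Type} {V : AffineVerifier α}

theorem sum_outcomeProb_eq_one {E : Type} [Fintype E] (v : E → ℚ) (r : RegisterOp E)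
    (hv : ∑ i, v i = 1) : ∑ o, outcomeProb v r o = 1 := by
  cases r with
  | apply A => simp [Fintype.sum_option, outcomeProb]
  | weight =>
    simp only [Fintype.sum_option, outcomeProb, zero_add, ← Finset.sum_div]
    -- A vector of norm zero is zero, so its entries could not have sum one.
    refine div_self fun h0 => ?_
    rw [Finset.sum_eq_zero_iff_of_nonneg (fun i _ => abs_nonneg _)] at h0
    have : ∑ i, v i = 0 := Finset.sum_eq_zero fun i hi => abs_eq_zero.mp (h0 i hi)
    rw [this] at hv
    exact zero_ne_one hv

theorem sum_mulVec_affineOperator {E : Type} [Fintype E] (A : AffineOperator E) (v : E → ℚ) :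
    ∑ i, A.1.mulVec v i = ∑ i, v i := by
  simp only [Matrix.mulVec, dotProduct]
  rw [Finset.sum_comm]
  simp only [← Finset.sum_mul, A.2, one_mul]

theorem sum_updateReg {E : Type} [Fintype E] [DecidableEq E] (v : E → ℚ) (r : RegisterOp E)
    (o : Option E) (hv : ∑ i, v i = 1) : ∑ i, updateReg v r o i = 1 := by
  cases r with
  | apply A => rw [updateReg, sum_mulVec_affineOperator, hv]
  | weight => cases o <;> simp [updateReg, hv]

/-- All registers of the configuration have entry sum one. -/
def Config.IsAffine (c : V.Config) : Prop := ∀ i, ∑ j, c.reg i j = 1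

theorem isAffine_initial : (V.initial).IsAffine := fun i => by simp [initial]

theorem Config.IsAffine.stepConfig {c : V.Config} (hc : c.IsAffine) (w : List α) (τ : V.Outcome) :
    (stepConfig w c τ).IsAffine := fun i => sum_updateReg _ _ _ (hc i)

theorem Config.IsAffine.sum_stepProb {c : V.Config} (hc : c.IsAffine) (w : List α) :
    ∑ τ : V.Outcome, stepProb w c τ = 1 := by
  have h := Fintype.prod_sum (fun i (o : Option (V.Basis i)) =>
    outcomeProb (c.reg i) (V.affinePart c.state (tapeAt w c.head) i) o)
  unfold stepProb
  rw [← h]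
  exact Finset.prod_eq_one fun i _ => sum_outcomeProb_eq_one _ _ (hc i)

/-- The expectation of a function of the outcome of a single register. -/
theorem Config.IsAffine.sum_stepProb_mul {c : V.Config} (hc : c.IsAffine) (w : List α) (i : V.Reg)
    (f : Option (V.Basis i) → ℚ) :
    ∑ τ : V.Outcome, stepProb w c τ * f (τ i) =
      ∑ o, outcomeProb (c.reg i) (V.affinePart c.state (tapeAt w c.head) i) o * f o := by
  classical
  set g : ∀ i', Option (V.Basis i') → ℚ := fun i' o =>
    outcomeProb (c.reg i') (V.affinePart c.state (tapeAt w c.head) i') o with hg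
  -- The product of the sums is expanded with only factor `i` weighted by `f`; all other factors are
  -- total probabilities, hence one.
  have h := Fintype.prod_sum (Function.update g i fun o => g i o * f o)
  rw [← Finset.mul_prod_erase Finset.univ _ (Finset.mem_univ i)] at h
  rw [Finset.prod_eq_one (s := Finset.univ.erase i), mul_one, Function.update_self] at h
  · rw [h]
    refine Finset.sum_congr rfl fun τ _ => ?_
    rw [stepProb, ← Finset.mul_prod_erase Finset.univ _ (Finset.mem_univ i),
      ← Finset.mul_prod_erase Finset.univ (fun j => _) (Finset.mem_univ i), Function.update_self,
      mul_right_comm]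
    congr 1
    refine Finset.prod_congr rfl fun j hj => ?_
    rw [Function.update_of_ne (Finset.ne_of_mem_erase hj)]
  · intro j hj
    rw [Function.update_of_ne (Finset.ne_of_mem_erase hj)]
    exact sum_outcomeProb_eq_one _ _ (hc j)

/-- For steps whose effect depends on a single weighting, this reduces the supermartingale
inequality to a sum over the outcomes of that register. -/
theorem Config.IsAffine.sum_stepProb_mul_le {c : V.Config} (hc : c.IsAffine) (w : List α)
    (i : V.Reg) (f : Option (V.Basis i) → ℚ) (F : V.Outcome → ℚ)
    (hF : ∀ τ, stepProb w c τ ≠ 0 → F τ ≤ f (τ i)) :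
    ∑ τ : V.Outcome, stepProb w c τ * F τ ≤
      ∑ o, outcomeProb (c.reg i) (V.affinePart c.state (tapeAt w c.head) i) o * f o := by
  rw [← hc.sum_stepProb_mul w i f]
  refine Finset.sum_le_sum fun τ _ => ?_
  by_cases h : stepProb w c τ = 0
  · simp [h]
  · exact mul_le_mul_of_nonneg_left (hF τ h) (stepProb_nonneg _ _ _)

theorem Config.IsAffine.sum_stepProb_mul_le_const {c : V.Config} (hc : c.IsAffine) (w : List α)
    (K : ℚ) (F : V.Outcome → ℚ) (hF : ∀ τ, stepProb w c τ ≠ 0 → F τ ≤ K) :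
    ∑ τ : V.Outcome, stepProb w c τ * F τ ≤ K := by
  calc ∑ τ : V.Outcome, stepProb w c τ * F τ ≤ ∑ τ : V.Outcome, stepProb w c τ * K := by
        refine Finset.sum_le_sum fun τ _ => ?_
        by_cases h : stepProb w c τ = 0
        · simp [h]
        · exact mul_le_mul_of_nonneg_left (hF τ h) (stepProb_nonneg _ _ _)
    _ = K := by rw [← Finset.sum_mul, hc.sum_stepProb w, one_mul]

theorem outcomeProb_ne_zero_of_stepProb_ne_zero {w : List α} {c : V.Config} {τ : V.Outcome}
    (h : stepProb w c τ ≠ 0) (i : V.Reg) :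
    outcomeProb (c.reg i) (V.affinePart c.state (tapeAt w c.head) i) (τ i) ≠ 0 :=
  fun h0 => h (Finset.prod_eq_zero (Finset.mem_univ i) h0)

/-! ### Supermartingale bound on acceptance and almost sure halting -/

/-- A set of configurations that no step of the verifier and no reply of a prover leaves. -/
structure IsClosed (w : List α) (I : V.Config → Prop) : Prop where
  affine : ∀ c, I c → c.IsAffine
  com : ∀ c, I c → ∀ g, V.kind c.state = .com g → ∀ r, I { c with state := V.onReply c.state r }
  work : ∀ c, I c → V.kind c.state = .work → ∀ τ, stepProb w c τ ≠ 0 → I (stepConfig w c τ)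

/-- A function on configurations which, whatever the prover does, does not increase in expectation,
and is at least one in accepting configurations, bounds the probability of acceptance. -/
theorem haltWithin_true_le {w : List α} {I : V.Config → Prop} (hI : IsClosed w I)
    (Φ : V.Config → ℚ) (h_nonneg : ∀ c, I c → 0 ≤ Φ c)
    (h_halt : ∀ c, I c → V.kind c.state = .halt true → 1 ≤ Φ c)
    (h_com : ∀ c, I c → ∀ g, V.kind c.state = .com g →
      ∀ r, Φ { c with state := V.onReply c.state r } ≤ Φ c)
    (h_work : ∀ c, I c → V.kind c.state = .work →
      ∑ τ : V.Outcome, stepProb w c τ * Φ (stepConfig w c τ) ≤ Φ c)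
    (P : V.Prover) (n : ℕ) (c : V.Config) (hc : I c) (h : List V.Event) :
    haltWithin P w true n c h ≤ Φ c := by
  induction n generalizing c h with
  | zero =>
    have h1 := h_nonneg c hc
    have h2 := h_halt c hc
    unfold haltWithin
    cases hk : V.kind c.state with
    | halt b => cases b <;> simp_all
    | com g => exact h1
    | work => exact h1
  | succ n ih =>
    have h1 := h_nonneg c hc
    have h2 := h_halt c hc
    unfold haltWithin
    cases hk : V.kind c.state with
    | halt b => cases b <;> simp_all
    | com g => exact (ih _ (hI.com c hc g hk _) _).trans (h_com c hc g hk _)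
    | work =>
      refine le_trans (Finset.sum_le_sum fun τ _ => ?_) (h_work c hc hk)
      by_cases h0 : stepProb w c τ = 0
      · simp [h0]
      · exact mul_le_mul_of_nonneg_left (ih _ (hI.work c hc hk τ h0) _) (stepProb_nonneg _ _ _)

/-- The probability of halting within `n` steps. -/
def haltSum (P : V.Prover) (w : List α) (n : ℕ) (c : V.Config) (h : List V.Event) : ℚ :=
  haltWithin P w true n c h + haltWithin P w false n c h

theorem haltSum_nonneg (P : V.Prover) (w : List α) (n : ℕ) (c : V.Config) (h : List V.Event) :
    0 ≤ haltSum P w n c h := add_nonneg (haltWithin_nonneg _ _ _ _ _ _) (haltWithin_nonneg _ _ _ _ _ _)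

theorem haltSum_halt {P : V.Prover} {w : List α} {n : ℕ} {c : V.Config} {h : List V.Event}
    {b : Bool} (hk : V.kind c.state = .halt b) : haltSum P w n c h = 1 := by
  cases n <;> cases b <;> simp [haltSum, haltWithin, hk]

theorem haltSum_com {P : V.Prover} {w : List α} {n : ℕ} {c : V.Config} {h : List V.Event}
    {g : V.Γ} (hk : V.kind c.state = .com g) :
    haltSum P w (n + 1) c h = haltSum P w n { c with state := V.onReply c.state (P w h) }
      (.message g (P w h) (V.onReply c.state (P w h)) :: h) := by
  simp [haltSum, haltWithin, hk]

theorem haltSum_work {P : V.Prover} {w : List α} {n : ℕ} {c : V.Config} {h : List V.Event}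
    (hk : V.kind c.state = .work) :
    haltSum P w (n + 1) c h = ∑ τ : V.Outcome, stepProb w c τ *
      haltSum P w n (stepConfig w c τ) (stepEvent w c τ :: h) := by
  simp [haltSum, haltWithin, hk, mul_add, Finset.sum_add_distrib]

/-- If a rank decreases in each step, except for steps that halt with probability at least `p`,
then halting within as many steps as the rank says has probability at least `p`. -/
theorem le_haltSum_of_rank {w : List α} {I : V.Config → Prop} (hI : IsClosed w I)
    (rank : V.Config → ℕ) {p : ℚ} (hp : p ≤ 1)
    (h_com : ∀ c, I c → ∀ g, V.kind c.state = .com g →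
      ∀ r, rank { c with state := V.onReply c.state r } < rank c)
    (h_work : ∀ c, I c → V.kind c.state = .work → 0 < rank c ∧
      ((∀ τ, stepProb w c τ ≠ 0 → rank (stepConfig w c τ) < rank c) ∨
      ∃ τ b, p ≤ stepProb w c τ ∧ V.kind (stepConfig w c τ).state = .halt b))
    (P : V.Prover) (n : ℕ) (c : V.Config) (hc : I c) (hn : rank c ≤ n) (h : List V.Event) :
    p ≤ haltSum P w n c h := by
  induction n generalizing c h with
  | zero =>
    cases hk : V.kind c.state with
    | halt b => rw [haltSum_halt hk]; exact hp
    | com g =>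
      have := h_com c hc g hk (P w h)
      omega
    | work =>
      have := (h_work c hc hk).1
      omega
  | succ n ih =>
    cases hk : V.kind c.state with
    | halt b => rw [haltSum_halt hk]; exact hp
    | com g =>
      rw [haltSum_com hk]
      have := h_com c hc g hk (P w h)
      exact ih _ (hI.com c hc g hk _) (by omega) _
    | work =>
      rw [haltSum_work hk]
      rcases (h_work c hc hk).2 with hr | ⟨τ, b, hτ, hb⟩
      · calc p = ∑ τ : V.Outcome, stepProb w c τ * p := by
              rw [← Finset.sum_mul, (hI.affine c hc).sum_stepProb w, one_mul]
          _ ≤ _ := by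
              refine Finset.sum_le_sum fun τ _ => ?_
              by_cases h0 : stepProb w c τ = 0
              · simp [h0]
              · have := hr τ h0
                exact mul_le_mul_of_nonneg_left
                  (ih _ (hI.work c hc hk τ h0) (by omega) _) (stepProb_nonneg _ _ _)
      -- The halting outcome alone contributes `p`; the other terms are nonnegative.
      · refine le_trans ?_ (Finset.single_le_sum
          (fun τ _ => mul_nonneg (stepProb_nonneg w c τ) (haltSum_nonneg _ _ _ _ _))
          (Finset.mem_univ τ))
        rw [haltSum_halt hb, mul_one]
        exact hτ

/-- Running `n` more steps after `m` steps. -/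
theorem le_haltSum_add {w : List α} {I : V.Config → Prop} (hI : IsClosed w I) (P : V.Prover)
    {n : ℕ} {q : ℚ} (h_le : ∀ c, I c → ∀ h, q ≤ haltSum P w n c h)
    (m : ℕ) (c : V.Config) (hc : I c) (h : List V.Event) :
    q + (1 - q) * haltSum P w m c h ≤ haltSum P w (n + m) c h := by
  induction m generalizing c h with
  | zero =>
    cases hk : V.kind c.state with
    | halt b => rw [haltSum_halt hk, haltSum_halt hk]; linarith
    | com g =>
      have : haltSum P w 0 c h = 0 := by simp [haltSum, haltWithin, hk]
      simpa [this] using h_le c hc h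
    | work =>
      have : haltSum P w 0 c h = 0 := by simp [haltSum, haltWithin, hk]
      simpa [this] using h_le c hc h
  | succ m ih =>
    rw [← add_assoc]
    cases hk : V.kind c.state with
    | halt b => rw [haltSum_halt hk, haltSum_halt hk]; linarith
    | com g =>
      rw [haltSum_com hk, haltSum_com hk]
      exact ih _ (hI.com c hc g hk _) _
    | work =>
      rw [haltSum_work hk, haltSum_work hk]
      calc _ = ∑ τ : V.Outcome, stepProb w c τ *
            (q + (1 - q) * haltSum P w m (stepConfig w c τ) (stepEvent w c τ :: h)) := by
              simp only [mul_add, Finset.sum_add_distrib, ← Finset.sum_mul,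
                (hI.affine c hc).sum_stepProb w, one_mul, Finset.mul_sum]
              congr 1
              exact Finset.sum_congr rfl fun τ _ => by ring
        _ ≤ _ := by
              refine Finset.sum_le_sum fun τ _ => ?_
              by_cases h0 : stepProb w c τ = 0
              · simp [h0]
              · exact mul_le_mul_of_nonneg_left (ih _ (hI.work c hc hk τ h0) _)
                  (stepProb_nonneg _ _ _)

/-- Every further block of `n` steps multiplies the bound on the probability of not having halted by
`1 - q`. -/
theorem one_sub_pow_le_haltSum {w : List α} {I : V.Config → Prop} (hI : IsClosed w I)
    (P : V.Prover) {n : ℕ} {q : ℚ} (hq : q ≤ 1) (h_le : ∀ c, I c → ∀ h, q ≤ haltSum P w n c h)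
    (k : ℕ) (c : V.Config) (hc : I c) (h : List V.Event) :
    1 - (1 - q) ^ k ≤ haltSum P w (n * k) c h := by
  induction k with
  | zero => simpa using haltSum_nonneg P w _ c h
  | succ k ih =>
    have h1 := le_haltSum_add hI P h_le (n * k) c hc h
    rw [Nat.mul_succ, add_comm (n * k) n]
    refine le_trans ?_ h1
    rw [pow_succ]
    nlinarith

theorem haltWithin_le_haltProb (P : V.Prover) (w : List α) (b : Bool) (n : ℕ) :
    (haltWithin P w b n V.initial [] : ℝ) ≤ haltProb P w b :=
  le_ciSup (bddAbove_haltWithin P w b) n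

theorem haltProb_le {P : V.Prover} {w : List α} {b : Bool} {x : ℝ}
    (h : ∀ n, (haltWithin P w b n V.initial [] : ℝ) ≤ x) : haltProb P w b ≤ x := ciSup_le h

/-- If the computation halts with probability at least `q > 0` within `n` steps from every
configuration of a closed set, then it halts almost surely. -/
theorem one_le_haltProb_add {w : List α} {I : V.Config → Prop} (hI : IsClosed w I)
    (h_init : I V.initial) (P : V.Prover) {n : ℕ} {q : ℚ} (hq0 : 0 < q) (hq : q ≤ 1)
    (h_le : ∀ c, I c → ∀ h, q ≤ haltSum P w n c h) :
    1 ≤ haltProb P w true + haltProb P w false := by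
  have hlim : Filter.Tendsto (fun k : ℕ => 1 - (1 - (q : ℝ)) ^ k) Filter.atTop (nhds (1 - 0)) := by
    refine tendsto_const_nhds.sub (tendsto_pow_atTop_nhds_zero_of_lt_one ?_ ?_)
    · have : (q : ℝ) ≤ 1 := by exact_mod_cast hq
      linarith
    · have : (0 : ℝ) < q := by exact_mod_cast hq0
      linarith
  rw [sub_zero] at hlim
  refine le_of_tendsto' hlim fun k => ?_
  have h1 := one_sub_pow_le_haltSum hI P hq h_le k V.initial h_init []
  have h2 : 1 - (1 - (q : ℝ)) ^ k ≤ (haltWithin P w true (n * k) V.initial [] : ℝ) +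
      (haltWithin P w false (n * k) V.initial [] : ℝ) := by
    exact_mod_cast h1
  exact h2.trans (add_le_add (haltWithin_le_haltProb _ _ _ _) (haltWithin_le_haltProb _ _ _ _))

/-! ### The honest prover, which reconstructs the configuration from the history -/

variable (V) in
/-- The configuration that the public history determines. -/
def replay (w : List α) : List V.Event → V.Config
  | [] => V.initial
  | .step _ _ o :: h => stepConfig w (replay w h) o
  | .message _ _ s :: h => { replay w h with state := s }

open Classical in
/-- The prover that tries to keep the configuration in a given set. -/
noncomputable def keepProver (G : List α → V.Config → Prop) : V.Prover := fun w h =>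
  if hr : ∃ r, G w { replay V w h with state := V.onReply (replay V w h).state r } then hr.choose
  else Classical.arbitrary _

/-- If the prover can stay in a set without rejecting configurations, then `keepProver` does. -/
theorem haltWithin_keepProver_false {G : List α → V.Config → Prop} {w : List α}
    (h_halt : ∀ c, G w c → V.kind c.state ≠ .halt false)
    (h_com : ∀ c, G w c → ∀ g, V.kind c.state = .com g →
      ∃ r, G w { c with state := V.onReply c.state r })
    (h_work : ∀ c, G w c → V.kind c.state = .work →
      ∀ τ, stepProb w c τ ≠ 0 → G w (stepConfig w c τ))
    (n : ℕ) (h : List V.Event) (hG : G w (replay V w h)) :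
    haltWithin (keepProver G) w false n (replay V w h) h = 0 := by
  induction n generalizing h with
  | zero =>
    have h1 := h_halt _ hG
    unfold haltWithin
    cases hk : V.kind (replay V w h).state with
    | halt b => cases b <;> simp_all
    | com g => rfl
    | work => rfl
  | succ n ih =>
    have h1 := h_halt _ hG
    unfold haltWithin
    cases hk : V.kind (replay V w h).state with
    | halt b => cases b <;> simp_all
    | com g =>
      have hr := h_com _ hG g hk
      refine ih (.message _ _ _ :: h) ?_
      simp only [replay]
      have : keepProver G w h = hr.choose := by simp [keepProver, hr]
      rw [this]
      exact hr.choose_spec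
    | work =>
      refine Finset.sum_eq_zero fun τ _ => ?_
      by_cases h0 : stepProb w (replay V w h) τ = 0
      · simp [h0]
      · have := ih (stepEvent w (replay V w h) τ :: h) (h_work _ hG hk τ h0)
        simp only [stepEvent, replay] at this ⊢
        rw [this, mul_zero]

end AffineVerifier

/-! ### The verifier for the Knapsack game -/

namespace KnapsackVerifier

open AffineVerifier

/-- The states of a pass over the input. The quantifiers `∀` and `∃` are coded by `false` and
`true`. In `par q o` and `num q o s d`, the Boolean in `o` tells whether the first number of the
pair is chosen, and `o = none` that the pair is skipped; `s` tells whether the second number is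
being read, and `d` whether some digit of it has been read. -/
inductive Ctrl where
  | start
  | sum
  | block
  | par (q : Bool) (o : Option Bool)
  | num (q : Bool) (o : Option Bool) (s d : Bool)
  | exq
  | ask
  deriving DecidableEq, Fintype

/-- The states of the verifier. It makes two passes over the input, `rewind` takes it from the first
one to the second, and `decay` from a successful second pass to the next round. -/
inductive St where
  | init
  | run (second : Bool) (k : Ctrl)
  | rewind
  | decay
  | halt (b : Bool)
  deriving DecidableEq, Fintype

/-- Whether the choices at a quantifier are made in a pass. If `seq` holds, those for `∀` are made
in the first pass, otherwise in the second; those for `∃` are always made in the second pass. -/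
def active (seq second q : Bool) : Bool := if second then q || !seq else !q && seq

/-- The pass may end here, or a new block may begin. -/
def Ctrl.isFinal : Ctrl → Bool
  | .sum => true
  | .block => true
  | _ => false

/-- The coin is tossed. -/
def flips (seq second : Bool) : Ctrl → KGSymbol → Bool
  | .sum, .all => active seq second false
  | .block, .all => active seq second false
  | _, _ => false

/-- The next state of a pass, where `o` is the outcome of the coin. -/
def next (seq second : Bool) : Ctrl → KGSymbol → Option Bool → Option Ctrl
  | .start, .bit _, _ => some .sum
  | .sum, .bit _, _ => some .sum
  | .sum, .all, o => some (.par false o)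
  | .block, .all, o => some (.par false o)
  | .par q c, .lpar, _ => some (.num q c false false)
  | .num q c s _, .bit _, _ => some (.num q c s true)
  | .num q c false true, .comma, _ => some (.num q c true false)
  | .num false _ true true, .rpar, _ => some .exq
  | .num true _ true true, .rpar, _ => some .block
  | .exq, .ex, _ => some (if active seq second true then .ask else .par true none)
  | _, _, _ => none

/-! ### Operators on the registers -/

/-- The contents of the main register if the difference of `S` and the numbers chosen so far is `t`
and the part of a chosen number that has been read is `-u`. -/
def vec (t u : ℚ) : Fin 4 → ℚ := ![1, t, u, -(t + u)]

/-- The operator `t ↦ 2 * t + b`. -/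
def opSum (b : Bool) : AffineOperator (Fin 4) :=
  ⟨!![1, 0, 0, 0; b.toNat, 2, 0, 0; 0, 0, 1, 0; -b.toNat, -1, 0, 1], fun j => by
    fin_cases j <;> (simp [Fin.sum_univ_four]; try norm_num)⟩

/-- The operator `u ↦ 2 * u - b`. -/
def opDigit (b : Bool) : AffineOperator (Fin 4) :=
  ⟨!![1, 0, 0, 0; 0, 1, 0, 0; -b.toNat, 0, 2, 0; b.toNat, 0, -1, 1], fun j => by
    fin_cases j <;> (simp [Fin.sum_univ_four]; try norm_num)⟩

/-- The operator `t ↦ t + u, u ↦ 0`. -/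
def opFlush : AffineOperator (Fin 4) :=
  ⟨!![1, 0, 0, 0; 0, 1, 1, 0; 0, 0, 0, 0; 0, 0, 0, 1], fun j => by
    fin_cases j <;> simp [Fin.sum_univ_four]⟩

/-- The operator that makes the first basis state the contents of a register. -/
def opReset : AffineOperator (Fin 4) :=
  ⟨!![1, 1, 1, 1; 0, 0, 0, 0; 0, 0, 0, 0; 0, 0, 0, 0], fun j => by
    fin_cases j <;> simp [Fin.sum_univ_four]⟩

def opId : AffineOperator (Fin 4) := ⟨1, fun j => by simp [Matrix.one_apply]⟩

/-- The operator that multiplies the first entry by `δ`. -/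
def opDecay (δ : ℚ) : AffineOperator (Fin 4) :=
  ⟨!![δ, 0, 0, 0; 1 - δ, 1, 1, 1; 0, 0, 0, 0; 0, 0, 0, 0], fun j => by
    fin_cases j <;> simp [Fin.sum_univ_four]⟩

/-- The operator that prepares the coin. -/
def opCoin : AffineOperator (Fin 4) :=
  ⟨fun _ _ => 1 / 4, fun j => by simp⟩

/-- The contents of the coin register that makes it a fair coin. -/
def coin : Fin 4 → ℚ := fun _ => 1 / 4

/-- The operator applied to the main register during a pass. -/
def passOp (second : Bool) : Ctrl → KGSymbol → AffineOperator (Fin 4)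
  | .start, .bit b => if second then opId else opSum b
  | .sum, .bit b => if second then opId else opSum b
  | .num _ c s _, .bit b => if c = some (!s) then opDigit b else opId
  | .num _ _ _ _, .comma => opFlush
  | .num _ _ _ _, .rpar => opFlush
  | _, _ => opId

theorem opSum_mulVec (b : Bool) (t u : ℚ) :
    (opSum b).1.mulVec (vec t u) = vec (2 * t + b.toNat) u := by
  ext i; fin_cases i <;> simp [opSum, vec, Matrix.mulVec, dotProduct, Fin.sum_univ_four] <;> ring

theorem opDigit_mulVec (b : Bool) (t u : ℚ) :
    (opDigit b).1.mulVec (vec t u) = vec t (2 * u - b.toNat) := by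
  ext i; fin_cases i <;> simp [opDigit, vec, Matrix.mulVec, dotProduct, Fin.sum_univ_four] <;> ring

theorem opFlush_mulVec (t u : ℚ) : opFlush.1.mulVec (vec t u) = vec (t + u) 0 := by
  ext i; fin_cases i <;> simp [opFlush, vec, Matrix.mulVec, dotProduct, Fin.sum_univ_four]

theorem opId_mulVec (v : Fin 4 → ℚ) : opId.1.mulVec v = v := by
  simp [opId]

theorem opReset_mulVec (v : Fin 4 → ℚ) (hv : ∑ i, v i = 1) : opReset.1.mulVec v = vec 0 0 := by
  rw [Fin.sum_univ_four] at hv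
  ext i; fin_cases i <;> simp [opReset, vec, Matrix.mulVec, dotProduct, Fin.sum_univ_four, hv]

theorem opCoin_mulVec (v : Fin 4 → ℚ) (hv : ∑ i, v i = 1) : opCoin.1.mulVec v = coin := by
  ext i; simp [opCoin, coin, Matrix.mulVec, dotProduct, ← Finset.mul_sum, hv]

theorem single_eq_vec : (Pi.single 0 1 : Fin 4 → ℚ) = vec 0 0 := by
  ext i; fin_cases i <;> simp [vec]

/-- The contents of the main register after `n` steps of the way back from a successful test. -/
def decayVec (δ : ℚ) (n : ℕ) : Fin 4 → ℚ := ![δ ^ n, 1 - δ ^ n, 0, 0]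

theorem opDecay_mulVec (δ : ℚ) (n : ℕ) :
    (opDecay δ).1.mulVec (decayVec δ n) = decayVec δ (n + 1) := by
  ext i
  fin_cases i <;>
    simp [opDecay, decayVec, Matrix.mulVec, dotProduct, Fin.sum_univ_four, pow_succ] <;> ring

theorem vec_zero_eq_decayVec (δ : ℚ) : vec 0 0 = decayVec δ 0 := by
  ext i; fin_cases i <;> simp [vec, decayVec]

theorem passOp_cases (second : Bool) (k : Ctrl) (a : KGSymbol) :
    passOp second k a = opId ∨ (∃ b, passOp second k a = opSum b) ∨
      (∃ b, passOp second k a = opDigit b) ∨ passOp second k a = opFlush := by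
  cases k <;> cases a <;> simp only [passOp, true_or, or_true] <;> split_ifs <;>
    first | exact .inl rfl | exact .inr (.inl ⟨_, rfl⟩) | exact .inr (.inr (.inl ⟨_, rfl⟩))

/-- Integrality keeps a wrong difference at distance at least one from zero, which is what the final
test needs. -/
theorem passOp_mulVec (second : Bool) (k : Ctrl) (a : KGSymbol) (t u : ℤ) :
    ∃ t' u' : ℤ, (passOp second k a).1.mulVec (vec t u) = vec t' u' := by
  have hid : ∃ t' u' : ℤ, opId.1.mulVec (vec t u) = vec t' u' := ⟨t, u, opId_mulVec _⟩
  have hsum : ∀ b, ∃ t' u' : ℤ, (opSum b).1.mulVec (vec t u) = vec t' u' := fun b =>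
    ⟨2 * t + b.toNat, u, by rw [opSum_mulVec]; push_cast; rfl⟩
  have hdig : ∀ b, ∃ t' u' : ℤ, (opDigit b).1.mulVec (vec t u) = vec t' u' := fun b =>
    ⟨t, 2 * u - b.toNat, by rw [opDigit_mulVec]; push_cast; rfl⟩
  have hfl : ∃ t' u' : ℤ, opFlush.1.mulVec (vec t u) = vec t' u' :=
    ⟨t + u, 0, by rw [opFlush_mulVec]; push_cast; rfl⟩
  rcases passOp_cases second k a with h | ⟨b, h⟩ | ⟨b, h⟩ | h <;> rw [h]
  exacts [hid, hsum b, hdig b, hfl]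

/-! ### The transition function -/

/-- The affine part of the transition function on the main register. -/
def mainPart (δ : ℚ) : St → TapeSymbol KGSymbol → RegisterOp (Fin 4)
  | .init, _ => .apply opReset
  | .run second k, .sym a => .apply (passOp second k a)
  | .run true k, .rightEnd => if k.isFinal then .weight else .apply opId
  | .decay, .leftEnd => .weight
  | .decay, _ => .apply (opDecay δ)
  | _, _ => .apply opId

/-- The affine part of the transition function on the coin register. -/
def coinPart (seq : Bool) : St → TapeSymbol KGSymbol → RegisterOp (Fin 4)
  | .run second k, .sym a => if flips seq second k a then .weight else .apply opCoin
  | _, _ => .apply opCoin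

/-- The outcome of the coin as a Boolean. -/
def coinSide (o : Option (Fin 4)) : Option Bool := o.map fun i => decide (i < 2)

/-- The deterministic part of the transition function, where `m` and `o` are the outcomes of the
main register and of the coin. -/
def move (seq : Bool) : St → TapeSymbol KGSymbol → (m o : Option (Fin 4)) → St × HeadMove
  | .init, .leftEnd, _, _ => (.run false .start, .right)
  | .run second k, .sym a, _, o => match next seq second k a (coinSide o) with
    | some k' => (.run second k', .right)
    | none => (.halt false, .stay)
  | .run second k, .rightEnd, m, _ =>
    if k.isFinal then
      if second then
        if m = some 0 then (.decay, .stay) else (.halt false, .stay)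
      else (.rewind, .left)
    else (.halt false, .stay)
  | .rewind, .leftEnd, _, _ => (.run true .start, .right)
  | .rewind, _, _, _ => (.rewind, .left)
  | .decay, .leftEnd, m, _ => (if m = some 0 then .halt true else .init, .stay)
  | .decay, _, _, _ => (.decay, .left)
  | _, _, _, _ => (.halt false, .stay)

/-- The verifier. Register `true` is the main register, register `false` is the coin. -/
def verifier (seq : Bool) (δ : ℚ) : AffineVerifier KGSymbol where
  State := St
  Γ := Bool
  Reg := Bool
  Basis _ := Fin 4
  start := .init
  startBasis _ := 0
  kind
    | .run _ .ask => .com true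
    | .halt b => .halt b
    | _ => .work
  affinePart s a i := if i then mainPart δ s a else coinPart seq s a
  detPart s a τ := move seq s a (τ true) (τ false)
  onReply
    | .run second .ask, r => .run second (.par true (some r))
    | s, _ => s
  no_exit_left s τ := by
    cases s <;> simp [move]
  no_exit_right s τ := by
    cases s <;> (simp only [move]; try split_ifs) <;> simp

/-! ### The game that a pass amounts to -/

/-- Where the prover is asked, some reply makes `F` true. -/
def withReply (F : Ctrl → Prop) : Ctrl → Prop
  | .ask => ∃ r, F (.par true (some r))
  | k => F k

/-- Whatever the outcomes of the coin are, the prover can complete a pass with contents of the main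
register that satisfy `goal`. The pass is in state `k`, which is not `ask`, the contents of the main
register is `v`, and the remaining part of the input is given. -/
def winFrom (seq second : Bool) (goal : (Fin 4 → ℚ) → Prop) :
    List KGSymbol → Ctrl → (Fin 4 → ℚ) → Prop
  | [], k, v => k.isFinal = true ∧ goal v
  | a :: l, k, v => ∀ o : Option Bool, o.isSome = flips seq second k a →
      ∃ k', next seq second k a o = some k' ∧
        withReply (fun k'' => winFrom seq second goal l k'' ((passOp second k a).1.mulVec v)) k'

/-- As `winFrom`, for an arbitrary state `k`. -/
def Wins (seq second : Bool) (goal : (Fin 4 → ℚ) → Prop) (l : List KGSymbol) (k : Ctrl)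
    (v : Fin 4 → ℚ) : Prop :=
  withReply (fun k => winFrom seq second goal l k v) k

/-- What the main register should satisfy at the end of a pass over `w`. -/
def Goal (seq : Bool) (w : List KGSymbol) (second : Bool) (v : Fin 4 → ℚ) : Prop :=
  if second then v = vec 0 0 else Wins seq true (· = vec 0 0) w .start v

theorem wins_ask {seq second : Bool} {goal : (Fin 4 → ℚ) → Prop} {l : List KGSymbol}
    {v : Fin 4 → ℚ} : Wins seq second goal l .ask v ↔
      ∃ r, Wins seq second goal l (.par true (some r)) v := Iff.rfl

theorem wins_nil {seq second : Bool} {goal : (Fin 4 → ℚ) → Prop} {k : Ctrl} (hk : k ≠ .ask)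
    {v : Fin 4 → ℚ} : Wins seq second goal [] k v ↔ k.isFinal = true ∧ goal v := by
  cases k <;> first | exact Iff.rfl | exact (hk rfl).elim

theorem wins_cons {seq second : Bool} {goal : (Fin 4 → ℚ) → Prop} {a : KGSymbol}
    {l : List KGSymbol} {k : Ctrl} (hk : k ≠ .ask) {v : Fin 4 → ℚ} :
    Wins seq second goal (a :: l) k v ↔ ∀ o : Option Bool, o.isSome = flips seq second k a →
      ∃ k', next seq second k a o = some k' ∧
        Wins seq second goal l k' ((passOp second k a).1.mulVec v) := by
  cases k <;> first | exact Iff.rfl | exact (hk rfl).elim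

theorem tapeAt_succ_of_lt {w : List KGSymbol} {j : ℕ} (hj : j < w.length) :
    tapeAt w (j + 1) = .sym w[j] := by
  simp [tapeAt, hj]

theorem tapeAt_length_succ (w : List KGSymbol) : tapeAt w (w.length + 1) = .rightEnd := by
  simp [tapeAt]

theorem tapeAt_succ_ne_leftEnd (w : List KGSymbol) (j : ℕ) : tapeAt w (j + 1) ≠ .leftEnd := by
  rw [tapeAt]
  split <;> simp

/-! ### The invariant and the positions from which the prover survives -/

/-- The invariant of the computation, in terms of the state, the head position and the contents of
the two registers. -/
def Inv (δ : ℚ) (w : List KGSymbol) : St → ℕ → (m c : Fin 4 → ℚ) → Prop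
  | .init, j, _, _ => j = 0
  | .run _ k, j, m, c => (∃ i ≤ w.length, j = i + 1) ∧ (∃ t u : ℤ, m = vec t u) ∧
      (k.isFinal = true → c = coin)
  | .rewind, j, m, _ => j ≤ w.length ∧ ∃ t u : ℤ, m = vec t u
  | .decay, j, m, _ => ∃ n, n + j = w.length + 1 ∧ m = decayVec δ n
  | .halt _, _, _, _ => True

/-- The prover can avoid rejection in every round on the input `w`. -/
def CanWin (seq : Bool) (w : List KGSymbol) : Prop :=
  Wins seq false (Goal seq w false) w .start (vec 0 0)

/-- Either the prover can avoid rejection in the current round, or the round is already over. -/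
def Survives (seq : Bool) (w : List KGSymbol) : St → ℕ → (Fin 4 → ℚ) → Prop
  | .init, _, _ => True
  | .run second k, j, m => Wins seq second (Goal seq w second) (w.drop (j - 1)) k m
  | .rewind, _, m => Goal seq w false m
  | .decay, _, _ => True
  | .halt b, _, _ => b = true

/-- Weighting never yields `none` and applying an operator yields nothing else, so a side of the
coin is seen exactly when it is tossed. -/
theorem coinSide_isSome {seq second : Bool} {k : Ctrl} {a : KGSymbol} {c : Fin 4 → ℚ}
    {o : Option (Fin 4)} (h : outcomeProb c (coinPart seq (.run second k) (.sym a)) o ≠ 0) :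
    (coinSide o).isSome = flips seq second k a := by
  unfold coinPart at h
  cases hf : flips seq second k a <;> cases o <;> simp_all [outcomeProb, coinSide]

theorem isFinal_of_flips {seq second : Bool} {k : Ctrl} {a : KGSymbol}
    (h : flips seq second k a = true) : k.isFinal = true := by
  cases k <;> cases a <;> simp_all [flips, Ctrl.isFinal]

/-- A toss leads to a `par` state, which is not final. Hence `opCoin` is applied in every step into
a final state, and the coin is fair again before the next toss. -/
theorem flips_false_of_next_isFinal {seq second : Bool} {k k' : Ctrl} {a : KGSymbol}
    {o : Option Bool} (h : next seq second k a o = some k') (hk : k'.isFinal = true) :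
    flips seq second k a = false := by
  cases hf : flips seq second k a
  · rfl
  · cases k <;> cases a <;> simp_all [flips, next] <;> subst h <;> simp [Ctrl.isFinal] at hk

theorem inv_step {seq : Bool} {δ : ℚ} {w : List KGSymbol} {s : St} {j : ℕ} {m c : Fin 4 → ℚ}
    (hm : ∑ i, m i = 1) (hc : ∑ i, c i = 1) (h : Inv δ w s j m c) {om oc : Option (Fin 4)}
    (hom : outcomeProb m (mainPart δ s (tapeAt w j)) om ≠ 0) :
    Inv δ w (move seq s (tapeAt w j) om oc).1 ((move seq s (tapeAt w j) om oc).2.apply j)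
      (updateReg m (mainPart δ s (tapeAt w j)) om)
      (updateReg c (coinPart seq s (tapeAt w j)) oc) := by
  cases s with
  | init =>
    obtain rfl : j = 0 := h
    refine ⟨⟨0, Nat.zero_le _, rfl⟩, ⟨0, 0, ?_⟩, by simp [Ctrl.isFinal]⟩
    exact_mod_cast opReset_mulVec m hm
  | run second k =>
    obtain ⟨⟨i, hi, rfl⟩, ⟨t, u, rfl⟩, hcoin⟩ := h
    rcases hi.lt_or_eq with hi | rfl
    · rw [tapeAt_succ_of_lt hi]
      simp only [move]
      cases hn : next seq second k w[i] (coinSide oc) with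
      | none => trivial
      | some k' =>
        refine ⟨⟨i + 1, hi, rfl⟩, passOp_mulVec second k w[i] t u, fun hk => ?_⟩
        rw [coinPart, flips_false_of_next_isFinal hn hk]
        exact opCoin_mulVec c hc
    · rw [tapeAt_length_succ] at hom ⊢
      simp only [move]
      cases hk : k.isFinal
      · trivial
      · cases second
        · exact ⟨le_rfl, t, u, opId_mulVec _⟩
        · by_cases h0 : om = some 0
          · subst h0
            simp only [if_true]
            -- A passed test collapses the register to the first basis vector, which is `decayVec δ
            -- 0`. The way back starts in cell `w.length + 1`, so the exponent is `w.length + 1` on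
            -- arrival in cell `0`.
            refine ⟨0, by simp [HeadMove.apply], ?_⟩
            simp only [mainPart, hk, if_true, updateReg]
            rw [single_eq_vec, vec_zero_eq_decayVec δ]
          · simp only [if_true, h0, if_false]
            trivial
  | rewind =>
    obtain ⟨hj, t, u, rfl⟩ := h
    cases j with
    | zero => exact ⟨⟨0, Nat.zero_le _, rfl⟩, ⟨t, u, opId_mulVec _⟩, by simp [Ctrl.isFinal]⟩
    | succ i =>
      have := tapeAt_succ_ne_leftEnd w i
      cases ht : tapeAt w (i + 1) with
      | leftEnd => exact absurd ht this
      | sym a => exact ⟨by simp only [move, HeadMove.apply]; omega, t, u, opId_mulVec _⟩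
      | rightEnd => exact ⟨by simp only [move, HeadMove.apply]; omega, t, u, opId_mulVec _⟩
  | decay =>
    obtain ⟨n, hn, rfl⟩ := h
    cases j with
    | zero =>
      simp only [tapeAt, move]
      split_ifs
      · trivial
      · rfl
    | succ i =>
      have := tapeAt_succ_ne_leftEnd w i
      cases ht : tapeAt w (i + 1) with
      | leftEnd => exact absurd ht this
      | sym a => exact ⟨n + 1, by simp only [move, HeadMove.apply]; omega, opDecay_mulVec δ n⟩
      | rightEnd => exact ⟨n + 1, by simp only [move, HeadMove.apply]; omega, opDecay_mulVec δ n⟩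
  | halt b => cases ht : tapeAt w j <;> trivial

theorem vec_injective {t u t' u' : ℚ} (h : vec t u = vec t' u') : t = t' ∧ u = u' :=
  ⟨by simpa [vec] using congrFun h 1, by simpa [vec] using congrFun h 2⟩

theorem outcomeProb_vec_zero {o : Option (Fin 4)}
    (h : outcomeProb (vec 0 0) .weight o ≠ 0) : o = some 0 := by
  cases o with
  | none => simp [outcomeProb] at h
  | some i => fin_cases i <;> simp [outcomeProb, vec] at h ⊢

/-- The first entry is `1`, and the other entries contribute at least `|t| + |u| ≥ 1` to the norm.
-/
theorem outcomeProb_vec_le_half {t u : ℤ} (h : vec t u ≠ vec 0 0) :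
    outcomeProb (vec t u) .weight (some 0) ≤ 1 / 2 := by
  have h1 : 1 ≤ |(t : ℚ)| + |(u : ℚ)| := by
    have : t ≠ 0 ∨ u ≠ 0 := by
      by_contra! h0
      exact h (by rw [h0.1, h0.2]; simp)
    have h2 : 1 ≤ |t| + |u| := by
      rcases this with h | h
      · have := Int.one_le_abs h
        have := abs_nonneg u
        omega
      · have := Int.one_le_abs h
        have := abs_nonneg t
        omega
    exact_mod_cast h2
  have h3 := abs_nonneg (-((t : ℚ) + u))
  simp only [outcomeProb, Fin.sum_univ_four]
  simp only [vec, Matrix.cons_val_zero, Matrix.cons_val_one, Matrix.cons_val, abs_one] at h3 ⊢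
  rw [div_le_div_iff₀ (by positivity) (by norm_num)]
  linarith

/-- During a pass this is the definition of `Wins`. At the end of the second pass the register is
exactly the first basis vector, so the test passes with certainty; a failed weighting in `decay`
only starts a new round. -/
theorem survives_step {seq : Bool} {δ : ℚ} {w : List KGSymbol} {s : St} {j : ℕ} {m c : Fin 4 → ℚ}
    (hw : CanWin seq w) (hm : ∑ i, m i = 1)
    (h : Inv δ w s j m c) (hs : Survives seq w s j m) (hk : ∀ b, s ≠ .run b .ask)
    (hb : ∀ b, s ≠ .halt b) {om oc : Option (Fin 4)}
    (hom : outcomeProb m (mainPart δ s (tapeAt w j)) om ≠ 0)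
    (hoc : outcomeProb c (coinPart seq s (tapeAt w j)) oc ≠ 0) :
    Survives seq w (move seq s (tapeAt w j) om oc).1 ((move seq s (tapeAt w j) om oc).2.apply j)
      (updateReg m (mainPart δ s (tapeAt w j)) om) := by
  cases s with
  | init =>
    obtain rfl : j = 0 := h
    have : updateReg m (mainPart δ .init (tapeAt w 0)) om = vec 0 0 := opReset_mulVec m hm
    rw [this]
    exact hw
  | run second k =>
    have hk' : k ≠ .ask := fun h => hk second (by rw [h])
    obtain ⟨⟨i, hi, rfl⟩, ⟨t, u, rfl⟩, -⟩ := h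
    simp only [Survives, Nat.add_sub_cancel] at hs
    rcases hi.lt_or_eq with hi | rfl
    · rw [tapeAt_succ_of_lt hi] at hoc ⊢
      rw [List.drop_eq_getElem_cons hi, wins_cons hk'] at hs
      obtain ⟨k', hn, hw⟩ := hs _ (coinSide_isSome hoc)
      simp only [move, hn]
      exact hw
    · rw [List.drop_length, wins_nil hk'] at hs
      rw [tapeAt_length_succ] at hom ⊢
      simp only [move, hs.1, if_true]
      cases second
      · simp only [Bool.false_eq_true, if_false, Survives, mainPart, updateReg]
        rw [opId_mulVec]
        exact hs.2
      · have h0 : vec t u = vec 0 0 := hs.2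
        rw [h0] at hom
        simp only [mainPart, hs.1, if_true] at hom
        rw [if_pos rfl, if_pos (outcomeProb_vec_zero hom)]
        trivial
  | rewind =>
    obtain ⟨hj, t, u, rfl⟩ := h
    cases j with
    | zero =>
      have : updateReg (vec t u) (mainPart δ .rewind (tapeAt w 0)) om = vec t u := opId_mulVec _
      rw [this]
      exact hs
    | succ i =>
      have := tapeAt_succ_ne_leftEnd w i
      have h2 : updateReg (vec t u) (mainPart δ .rewind (tapeAt w (i + 1))) om = vec t u :=
        opId_mulVec _
      rw [h2]
      cases ht : tapeAt w (i + 1) with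
      | leftEnd => exact absurd ht this
      | sym a => exact hs
      | rightEnd => exact hs
  | decay =>
    cases j with
    | zero =>
      simp only [tapeAt, move]
      split_ifs
      · exact rfl
      · exact trivial
    | succ i =>
      have := tapeAt_succ_ne_leftEnd w i
      cases ht : tapeAt w (i + 1) with
      | leftEnd => exact absurd ht this
      | sym a => exact trivial
      | rightEnd => exact trivial
  | halt b => exact absurd rfl (hb b)

/-! ### Length of a round -/

/-- A bound on the number of steps until the computation halts or the next round begins. -/
def rank (w : List KGSymbol) : St → ℕ → ℕ
  | .init, _ => 6 * w.length + 6
  -- A cell may cost two steps, a move and a reply, hence the factor `2`. The additive constants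
  -- make the rank drop at each change of phase.
  | .run second k, j => 2 * (w.length + 1 - j) + (if k = .ask then 1 else 0) +
      if second then w.length + 3 else 4 * w.length + 5
  | .rewind, j => j + 3 * w.length + 4
  | .decay, j => j + 1
  | .halt _, _ => 0

theorem rank_le {δ : ℚ} {w : List KGSymbol} {s : St} {j : ℕ} {m c : Fin 4 → ℚ}
    (h : Inv δ w s j m c) : rank w s j ≤ 6 * w.length + 6 := by
  cases s with
  | init => exact le_rfl
  | run second k =>
    obtain ⟨⟨i, hi, rfl⟩, -⟩ := h
    simp only [rank]
    split_ifs <;> omega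
  | rewind => have := h.1; simp only [rank]; omega
  | decay => obtain ⟨n, hn, -⟩ := h; simp only [rank]; omega
  | halt b => exact Nat.zero_le _

/-- The step excluded by `hd` is the one that may begin a new round; there the rank can grow, and
the probability of halting is used instead. -/
theorem rank_step {seq : Bool} {δ : ℚ} {w : List KGSymbol} {s : St} {j : ℕ} {m c : Fin 4 → ℚ}
    (h : Inv δ w s j m c) (hk : ∀ b, s ≠ .run b .ask) (hb : ∀ b, s ≠ .halt b)
    (hd : s = .decay → j ≠ 0) (om oc : Option (Fin 4)) :
    rank w (move seq s (tapeAt w j) om oc).1 ((move seq s (tapeAt w j) om oc).2.apply j) <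
      rank w s j := by
  cases s with
  | init =>
    obtain rfl : j = 0 := h
    simp only [tapeAt, move, HeadMove.apply, rank]
    simp
    omega
  | run second k =>
    have hk' : k ≠ .ask := fun h => hk second (by rw [h])
    obtain ⟨⟨i, hi, rfl⟩, -⟩ := h
    rcases hi.lt_or_eq with hi | rfl
    · rw [tapeAt_succ_of_lt hi]
      simp only [move]
      cases hn : next seq second k w[i] (coinSide oc) with
      | none => simp only [rank]; split_ifs <;> omega
      | some k' => simp only [rank, HeadMove.apply, if_neg hk']; split_ifs <;> omega
    · rw [tapeAt_length_succ]
      simp only [move]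
      split_ifs <;> simp only [rank, HeadMove.apply, *] <;> simp <;>
        (try split_ifs) <;> omega
  | rewind =>
    cases j with
    | zero => simp [tapeAt, move, rank, HeadMove.apply]; omega
    | succ i =>
      have := tapeAt_succ_ne_leftEnd w i
      cases ht : tapeAt w (i + 1) with
      | leftEnd => exact absurd ht this
      | sym a => simp [move, rank, HeadMove.apply]
      | rightEnd => simp [move, rank, HeadMove.apply]
  | decay =>
    cases j with
    | zero => exact absurd rfl (hd rfl)
    | succ i =>
      have := tapeAt_succ_ne_leftEnd w i
      cases ht : tapeAt w (i + 1) with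
      | leftEnd => exact absurd ht this
      | sym a => simp [move, rank, HeadMove.apply]
      | rightEnd => simp [move, rank, HeadMove.apply]
  | halt b => exact absurd rfl (hb b)

/-! ### The potential for soundness -/

/-- `A` if the prover can avoid rejection in the current round, and otherwise slightly less, where
at most `e` tosses of the coin are left. -/
noncomputable def bound (A : ℚ) (p : Prop) (e : ℕ) : ℚ :=
  -- The factor `(1 / 2) ^ e` accounts for unfavourable tosses, the remaining `1 / 2` for the final
  -- test.
  open Classical in if p then A else A * (1 - (1 / 2) ^ (e + 1))

theorem bound_le {A : ℚ} (hA : 0 ≤ A) (p : Prop) (e : ℕ) : bound A p e ≤ A := by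
  unfold bound
  split_ifs
  · exact le_rfl
  · exact mul_le_of_le_one_right hA (by have : (0 : ℚ) ≤ (1 / 2) ^ (e + 1) := by positivity
                                        linarith)

theorem bound_nonneg {A : ℚ} (hA : 0 ≤ A) (p : Prop) (e : ℕ) : 0 ≤ bound A p e := by
  unfold bound
  split_ifs
  · exact hA
  · exact mul_nonneg hA (sub_nonneg.2 (pow_le_one₀ (by norm_num) (by norm_num)))

theorem bound_mono {A : ℚ} (hA : 0 ≤ A) {p p' : Prop} {e e' : ℕ} (hp : p' → p) (he : e' ≤ e) :
    bound A p' e' ≤ bound A p e := by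
  by_cases h : p
  · rw [bound, bound, if_pos h]
    exact bound_le hA p' e'
  · rw [bound, bound, if_neg h, if_neg (mt hp h)]
    refine mul_le_mul_of_nonneg_left (sub_le_sub_left ?_ _) hA
    exact pow_le_pow_of_le_one (by norm_num) (by norm_num) (by omega)

/-- A bound on the probability of acceptance, where `ε` and `A` are bounds on this probability at
the beginning and at the end of a round. -/
noncomputable def potential (seq : Bool) (ε A : ℚ) (w : List KGSymbol) :
    St → ℕ → (Fin 4 → ℚ) → ℚ
  | .init, _, _ => ε
  | .run second k, j, m =>
      bound A (Wins seq second (Goal seq w second) (w.drop (j - 1)) k m)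
        -- Unread cells bound the tosses to come; during the first pass `w.length` is reserved for
        -- the second.
        (w.length + 1 - j + if second then 0 else w.length)
  | .rewind, _, m => bound A (Goal seq w false m) w.length
  | .decay, _, _ => A
  | .halt b, _, _ => if b then 1 else 0

theorem potential_nonneg {seq : Bool} {ε A : ℚ} (hε : 0 ≤ ε) (hA : 0 ≤ A) (w : List KGSymbol)
    (s : St) (j : ℕ) (m : Fin 4 → ℚ) : 0 ≤ potential seq ε A w s j m := by
  cases s with
  | init => exact hε
  | run second k => exact bound_nonneg hA _ _
  | rewind => exact bound_nonneg hA _ _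
  | decay => exact hA
  | halt b => cases b <;> simp [potential]

/-- In all steps but tosses of the coin and weightings of the main register the potential does not
increase. -/
theorem potential_step_le {seq : Bool} {δ ε A : ℚ} (hA : 0 ≤ A) {w : List KGSymbol}
    (hε : bound A False (2 * w.length) ≤ ε) (hw : ¬ CanWin seq w)
    {s : St} {j : ℕ} {m c : Fin 4 → ℚ} (hm : ∑ i, m i = 1)
    (h : Inv δ w s j m c) (hk : ∀ b, s ≠ .run b .ask) (hb : ∀ b, s ≠ .halt b)
    (hmain : mainPart δ s (tapeAt w j) ≠ .weight) (hcoin : coinPart seq s (tapeAt w j) ≠ .weight)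
    {om oc : Option (Fin 4)}
    (hom : outcomeProb m (mainPart δ s (tapeAt w j)) om ≠ 0)
    (hoc : outcomeProb c (coinPart seq s (tapeAt w j)) oc ≠ 0) :
    potential seq ε A w (move seq s (tapeAt w j) om oc).1
        ((move seq s (tapeAt w j) om oc).2.apply j)
        (updateReg m (mainPart δ s (tapeAt w j)) om) ≤ potential seq ε A w s j m := by
  cases s with
  | init =>
    obtain rfl : j = 0 := h
    have : updateReg m (mainPart δ .init (tapeAt w 0)) om = vec 0 0 := opReset_mulVec m hm
    rw [this]
    refine le_trans ?_ hε
    refine bound_mono hA hw ?_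
    simp [move, tapeAt, HeadMove.apply]
    omega
  | run second k =>
    have hk' : k ≠ .ask := fun h => hk second (by rw [h])
    obtain ⟨⟨i, hi, rfl⟩, ⟨t, u, rfl⟩, -⟩ := h
    rcases hi.lt_or_eq with hi | rfl
    · rw [tapeAt_succ_of_lt hi] at hoc hcoin ⊢
      have hf : flips seq second k w[i] = false := by
        rw [← Bool.not_eq_true]
        exact fun hf => hcoin (by simp [coinPart, hf])
      have hs := coinSide_isSome hoc
      simp only [move]
      cases hn : next seq second k w[i] (coinSide oc) with
      | none => exact bound_nonneg hA _ _
      | some k' =>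
        refine bound_mono hA (fun hwin => ?_) (by simp only [HeadMove.apply]; omega)
        rw [Nat.add_sub_cancel, List.drop_eq_getElem_cons hi, wins_cons hk']
        -- Without a toss `none` is the only outcome, so the actual successor decides whether the
        -- position is won.
        intro o ho
        rw [hf] at ho hs
        rw [Option.isSome_eq_false_iff, Option.isNone_iff_eq_none] at ho hs
        rw [ho, ← hs]
        exact ⟨k', hn, hwin⟩
    · rw [tapeAt_length_succ] at hmain ⊢
      simp only [move]
      cases hf : k.isFinal
      · exact bound_nonneg hA _ _
      · cases second
        · refine bound_mono hA (fun hwin => ?_) (by simp)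
          rw [Nat.add_sub_cancel, List.drop_length, wins_nil hk']
          refine ⟨hf, ?_⟩
          simp only [mainPart, updateReg, opId_mulVec] at hwin
          exact hwin
        · exact absurd (by simp [mainPart, hf]) hmain
  | rewind =>
    obtain ⟨hj, t, u, rfl⟩ := h
    cases j with
    | zero =>
      have : updateReg (vec t u) (mainPart δ .rewind (tapeAt w 0)) om = vec t u := opId_mulVec _
      rw [this]
      exact bound_mono hA id (by simp [move, tapeAt, HeadMove.apply])
    | succ i =>
      have := tapeAt_succ_ne_leftEnd w i
      have h2 : updateReg (vec t u) (mainPart δ .rewind (tapeAt w (i + 1))) om = vec t u :=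
        opId_mulVec _
      rw [h2]
      cases ht : tapeAt w (i + 1) with
      | leftEnd => exact absurd ht this
      | sym a => exact le_rfl
      | rightEnd => exact le_rfl
  | decay =>
    cases j with
    | zero => exact absurd rfl hmain
    | succ i =>
      have := tapeAt_succ_ne_leftEnd w i
      cases ht : tapeAt w (i + 1) with
      | leftEnd => exact absurd ht this
      | sym a => exact le_rfl
      | rightEnd => exact le_rfl
  | halt b => exact absurd rfl (hb b)

/-- A toss of the coin. -/
theorem sum_coin_mul_potential_le {seq second : Bool} {ε A : ℚ} (hA : 0 ≤ A) {w : List KGSymbol}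
    {k : Ctrl} (hk : k ≠ .ask) {i : ℕ} (hi : i < w.length) (hf : flips seq second k w[i] = true)
    (m : Fin 4 → ℚ) :
    ∑ oc, outcomeProb coin .weight oc *
      potential seq ε A w (move seq (.run second k) (.sym w[i]) none oc).1
        ((move seq (.run second k) (.sym w[i]) none oc).2.apply (i + 1))
        ((passOp second k w[i]).1.mulVec m) ≤ potential seq ε A w (.run second k) (i + 1) m := by
  set F : Option (Fin 4) → ℚ := fun oc =>
    potential seq ε A w (move seq (.run second k) (.sym w[i]) none oc).1
        ((move seq (.run second k) (.sym w[i]) none oc).2.apply (i + 1))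
        ((passOp second k w[i]).1.mulVec m) with hF
  have hsum : ∑ oc, outcomeProb coin .weight oc * F oc =
      (F (some 0) + F (some 1) + F (some 2) + F (some 3)) / 4 := by
    simp [Fintype.sum_option, Fin.sum_univ_four, outcomeProb, coin]
    ring
  have hA' : ∀ oc, F oc ≤ A := by
    intro oc
    simp only [hF, move]
    cases next seq second k w[i] (coinSide oc) with
    | none => exact hA
    | some k' => exact bound_le hA _ _
  set e := w.length + 1 - (i + 1) + if second then 0 else w.length with he
  have hlose : ∀ b, (∀ k', next seq second k w[i] (some b) = some k' →
      ¬ Wins seq second (Goal seq w second) (w.drop (i + 1)) k'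
        ((passOp second k w[i]).1.mulVec m)) →
      ∀ oc, coinSide oc = some b → F oc ≤ A * (1 - (1 / 2) ^ e) := by
    intro b hb oc hoc
    simp only [hF, move]
    rw [hoc]
    cases hn : next seq second k w[i] (some b) with
    | none =>
      exact mul_nonneg hA (sub_nonneg.2 (pow_le_one₀ (by norm_num) (by norm_num)))
    | some k' =>
      have := hb k' hn
      simp only [potential, HeadMove.apply, bound]
      -- The toss uses up one cell, which exactly cancels the `+ 1` in the exponent of `bound`.
      rw [show w.length + 1 - (i + 1 + 1) + (if second then 0 else w.length) + 1 = e by omega]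
      exact (if_neg this).le
  change ∑ oc, outcomeProb coin .weight oc * F oc ≤ _
  rw [hsum]
  simp only [potential, ← he]
  by_cases hwin : Wins seq second (Goal seq w second) (w.drop (i + 1 - 1)) k m
  · rw [bound, if_pos hwin]
    linarith [hA' (some 0), hA' (some 1), hA' (some 2), hA' (some 3)]
  -- A lost position has a losing side `b`. The mean of `A` and `A * (1 - (1 / 2) ^ e)` is `A * (1 -
  -- (1 / 2) ^ (e + 1))`.
  · rw [bound, if_neg hwin, pow_succ]
    rw [Nat.add_sub_cancel, List.drop_eq_getElem_cons hi, wins_cons hk, hf] at hwin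
    push Not at hwin
    obtain ⟨o, ho, hno⟩ := hwin
    obtain ⟨b, rfl⟩ := Option.isSome_iff_exists.1 ho
    have := hlose b hno
    cases b
    · have h2 := this (some 2) (by decide)
      have h3 := this (some 3) (by decide)
      linarith [hA' (some 0), hA' (some 1)]
    · have h0 := this (some 0) (by decide)
      have h1 := this (some 1) (by decide)
      linarith [hA' (some 2), hA' (some 3)]

/-- The test at the end of the second pass. -/
theorem sum_main_mul_potential_le {seq : Bool} {ε A : ℚ} (hA : 0 ≤ A) {w : List KGSymbol}
    {k : Ctrl} (hk : k ≠ .ask) (hf : k.isFinal = true) (t u : ℤ) :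
    ∑ om, outcomeProb (vec t u) .weight om * (if om = some 0 then A else 0) ≤
      potential seq ε A w (.run true k) (w.length + 1) (vec t u) := by
  simp only [mul_ite, mul_zero, Finset.sum_ite_eq', Finset.mem_univ, if_true, potential,
    Nat.add_sub_cancel, List.drop_length, wins_nil hk, hf, true_and, Goal, Nat.sub_self, add_zero]
  by_cases h : vec t u = vec 0 0
  · rw [bound, if_pos h, h]
    simp [outcomeProb, vec, Fin.sum_univ_four]
  · rw [bound, if_neg h]
    have := outcomeProb_vec_le_half h
    nlinarith

/-! ### Halting, soundness and completeness of the verifier -/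

variable {seq : Bool} {δ : ℚ}

/-- The invariant of the computation. -/
def ConfigInv (w : List KGSymbol) (c : (verifier seq δ).Config) : Prop :=
  Inv δ w c.state c.head (c.reg true) (c.reg false) ∧ c.IsAffine

theorem exists_run_ask_of_kind {s : St} {g : Bool} (h : (verifier seq δ).kind s = .com g) :
    ∃ second, s = .run second .ask := by
  rcases s with _ | ⟨second, k⟩ | _ | _ | b
  case run => cases k <;> first | exact ⟨_, rfl⟩ | cases h
  all_goals cases h

theorem ne_ask_of_kind {s : St} (h : (verifier seq δ).kind s = .work) (b : Bool) :
    s ≠ .run b .ask := by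
  rintro rfl
  cases h

theorem ne_halt_of_kind {s : St} (h : (verifier seq δ).kind s = .work) (b : Bool) :
    s ≠ .halt b := by
  rintro rfl
  cases h

theorem eq_halt_of_kind {s : St} {b : Bool} (h : (verifier seq δ).kind s = .halt b) :
    s = .halt b := by
  rcases s with _ | ⟨second, k⟩ | _ | _ | b
  case run => cases k <;> cases h
  all_goals cases h
  rfl

theorem configInv_initial (w : List KGSymbol) : ConfigInv w (verifier seq δ).initial :=
  ⟨rfl, isAffine_initial⟩

theorem isClosed_configInv (w : List KGSymbol) :
    IsClosed w (ConfigInv w : (verifier seq δ).Config → Prop) where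
  affine c hc := hc.2
  com c hc g hg r := by
    refine ⟨?_, hc.2⟩
    rcases c with ⟨s, j, reg⟩
    obtain ⟨second, rfl⟩ := exists_run_ask_of_kind hg
    obtain ⟨⟨h1, h2, -⟩, -⟩ := hc
    exact ⟨h1, h2, fun h => Bool.noConfusion h⟩
  work c hc hk τ hτ := by
    refine ⟨?_, hc.2.stepConfig w τ⟩
    exact inv_step (hc.2 true) (hc.2 false) hc.1 (outcomeProb_ne_zero_of_stepProb_ne_zero hτ true)

theorem stepProb_eq (w : List KGSymbol) (c : (verifier seq δ).Config)
    (τ : (verifier seq δ).Outcome) : stepProb w c τ =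
      outcomeProb (E := Fin 4) (c.reg true) (mainPart δ c.state (tapeAt w c.head)) (τ true) *
      outcomeProb (E := Fin 4) (c.reg false) (coinPart seq c.state (tapeAt w c.head)) (τ false) :=
  Fintype.prod_bool _

theorem outcomeProb_decayVec_zero (hδ0 : 0 ≤ δ) (hδ1 : δ ≤ 1) (n : ℕ) :
    outcomeProb (decayVec δ n) .weight (some 0) = δ ^ n := by
  have h0 := pow_nonneg hδ0 n
  have h1 := pow_le_one₀ hδ0 hδ1 (n := n)
  simp only [outcomeProb, Fin.sum_univ_four]
  simp [decayVec, abs_of_nonneg h0, abs_of_nonneg (sub_nonneg.2 h1)]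

/-- Acceptance contributes `δ ^ n`, and a new round, worth `ε`, contributes at most `ε`. -/
theorem sum_outcomeProb_decayVec (hδ0 : 0 ≤ δ) (hδ1 : δ ≤ 1) (n : ℕ) {ε : ℚ} (hε : 0 ≤ ε) :
    ∑ o, outcomeProb (decayVec δ n) .weight o * (if o = some 0 then 1 else ε) ≤ ε + δ ^ n := by
  have h0 := pow_nonneg hδ0 n
  have h1 := pow_le_one₀ hδ0 hδ1 (n := n)
  simp only [Fintype.sum_option, outcomeProb, Fin.sum_univ_four]
  simp [decayVec, abs_of_nonneg h0, abs_of_nonneg (sub_nonneg.2 h1)]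
  nlinarith

theorem le_haltSum_verifier (hδ0 : 0 ≤ δ) (hδ1 : δ ≤ 1) (w : List KGSymbol)
    (P : (verifier seq δ).Prover) (c : (verifier seq δ).Config) (hc : ConfigInv w c)
    (h : List (verifier seq δ).Event) :
    δ ^ (w.length + 1) ≤ haltSum P w (6 * w.length + 6) c h := by
  refine le_haltSum_of_rank (isClosed_configInv w) (fun c => rank w c.state c.head)
    (pow_le_one₀ hδ0 hδ1) ?_ ?_ P _ c hc (rank_le hc.1) h
  · rintro ⟨s, j, reg⟩ - g hg r
    obtain ⟨second, rfl⟩ := exists_run_ask_of_kind hg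
    simp [rank, verifier]
  · rintro ⟨s, j, reg⟩ hc hk
    by_cases hd : s = .decay ∧ j = 0
    · obtain ⟨rfl, rfl⟩ := hd
      -- In cell `0` only the main register is weighted; its first outcome accepts. The coin has
      -- outcome `none` with probability one.
      refine ⟨Nat.succ_pos _, .inr ⟨fun i : Bool => if i then some (0 : Fin 4) else none, true, ?_, rfl⟩⟩
      obtain ⟨⟨n, hn, hreg⟩, -⟩ := hc
      refine le_of_le_of_eq ?_ (stepProb_eq w _ _).symm
      change _ ≤ outcomeProb (E := Fin 4) (reg true) .weight (some 0) * 1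
      obtain rfl : n = w.length + 1 := hn
      change reg true = _ at hreg
      rw [hreg, outcomeProb_decayVec_zero hδ0 hδ1, mul_one]
    · have := fun τ : (verifier seq δ).Outcome => rank_step (seq := seq) hc.1 (ne_ask_of_kind hk)
        (ne_halt_of_kind hk) (fun h1 h2 => hd ⟨h1, h2⟩) (τ true) (τ false)
      exact ⟨(Nat.zero_le _).trans_lt (this fun _ => none), .inl fun τ _ => this τ⟩

/-- With `y = (1 / 4) ^ (n + 1)`, accepting adds at most `ε * y` to the potential, while a round
loses at least the fraction `2 * y` of it. The denominator `4` in `δ` matches the at most two tosses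
per input symbol. -/
theorem bound_restart_le {ε : ℚ} (hε0 : 0 ≤ ε) (hε1 : ε ≤ 1) (n : ℕ) :
    bound (ε + (ε / 4) ^ (n + 1)) False (2 * n) ≤ ε := by
  set y : ℚ := (1 / 4) ^ (n + 1) with hy
  have hy0 : 0 ≤ y := by positivity
  have h1 : (ε / 4) ^ (n + 1) = ε ^ (n + 1) * y := by rw [hy, ← mul_pow]; ring
  have h2 : ((1 : ℚ) / 2) ^ (2 * n + 1) = 2 * y := by
    rw [hy, pow_succ, pow_succ, pow_mul]; norm_num; ring
  have h3 : ε ^ (n + 1) ≤ ε := pow_le_of_le_one hε0 hε1 n.succ_ne_zero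
  have hy1 : 2 * y ≤ 1 := h2 ▸ pow_le_one₀ (by norm_num) (by norm_num)
  rw [bound, if_neg id, h1, h2]
  calc (ε + ε ^ (n + 1) * y) * (1 - 2 * y) ≤ (ε + ε * y) * (1 - 2 * y) := by gcongr
    _ ≤ ε := by nlinarith [mul_nonneg hε0 hy0, mul_nonneg (mul_nonneg hε0 hy0) hy0]

/-- No step weights both registers: the coin is weighted only on input symbols, the main register
only on end-markers. So each step is a test or decay weighting, a toss, or free of randomness. -/
theorem haltWithin_true_verifier_le {ε : ℚ} (hε0 : 0 ≤ ε) (hε1 : ε ≤ 1) {w : List KGSymbol}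
    (hw : ¬ CanWin seq w) (P : (verifier seq (ε / 4)).Prover) (n : ℕ) :
    haltWithin P w true n (verifier seq (ε / 4)).initial [] ≤ ε := by
  have hδ0 : 0 ≤ ε / 4 := by positivity
  have hδ1 : ε / 4 ≤ 1 := by linarith
  have hA : 0 ≤ ε + (ε / 4) ^ (w.length + 1) := by positivity
  refine haltWithin_true_le (isClosed_configInv w)
    (fun c => potential seq ε (ε + (ε / 4) ^ (w.length + 1)) w c.state c.head (c.reg true))
    (fun c _ => potential_nonneg hε0 hA w _ _ _) ?_ ?_ ?_ P n _ (configInv_initial w) []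
  · rintro ⟨s, j, reg⟩ - hk
    rw [show s = .halt true from eq_halt_of_kind hk]
    exact le_rfl
  · rintro ⟨s, j, reg⟩ - g hg r
    obtain ⟨second, rfl⟩ := exists_run_ask_of_kind hg
    exact bound_mono hA (fun h => ⟨r, h⟩) le_rfl
  · rintro ⟨s, j, reg⟩ hc hk
    by_cases hmain : mainPart (ε / 4) s (tapeAt w j) = .weight
    · cases s with
      | init => cases hmain
      | rewind => cases hmain
      | halt b => cases hmain
      | run second k =>
        have hk' : k ≠ .ask := fun h => ne_ask_of_kind hk second (by rw [h])
        obtain ⟨⟨⟨i, hi, rfl⟩, ⟨t, u, hreg⟩, -⟩, -⟩ := id hc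
        change reg true = _ at hreg
        rcases hi.lt_or_eq with hi | hi
        · rw [tapeAt_succ_of_lt hi] at hmain
          cases hmain
        subst hi
        rw [tapeAt_length_succ] at hmain
        cases second
        · cases hmain
        have hf : k.isFinal = true := by
          by_contra hf
          simp [mainPart, hf] at hmain
        have h1 := sum_main_mul_potential_le (ε := ε) (seq := seq) (w := w) hA hk' hf t u
        refine le_trans (hc.2.sum_stepProb_mul_le w true (fun om : Option (Fin 4) => if om = some (0 : Fin 4) then
          ε + (ε / 4) ^ (w.length + 1) else 0) _ ?_) ?_
        · intro τ hτ
          simp only [stepConfig, verifier]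
          rw [tapeAt_length_succ]
          simp only [move, hf, if_true]
          split_ifs <;> exact le_rfl
        · simp only [verifier]
          rw [tapeAt_length_succ]
          simp only [if_true, hmain]
          rw [hreg]
          exact h1
      | decay =>
        cases j with
        | zero =>
          obtain ⟨⟨m, hm, hreg⟩, -⟩ := id hc
          change reg true = _ at hreg
          obtain rfl : m = w.length + 1 := hm
          have h1 := sum_outcomeProb_decayVec hδ0 hδ1 (w.length + 1) hε0
          refine le_trans (hc.2.sum_stepProb_mul_le w true (fun om : Option (Fin 4) => if om = some (0 : Fin 4) then
            1 else ε) _ ?_) ?_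
          · intro τ hτ
            simp only [stepConfig, verifier, tapeAt, move]
            split_ifs <;> exact le_rfl
          · simp only [verifier, tapeAt, if_true, mainPart]
            rw [hreg]
            exact h1
        | succ i =>
          have := tapeAt_succ_ne_leftEnd w i
          cases ht : tapeAt w (i + 1) with
          | leftEnd => exact absurd ht this
          | sym a => rw [ht] at hmain; cases hmain
          | rightEnd => rw [ht] at hmain; cases hmain
    · by_cases hcoin : coinPart seq s (tapeAt w j) = .weight
      · cases s with
        | init => cases hcoin
        | rewind => cases hcoin
        | decay => cases hcoin
        | halt b => cases hcoin
        | run second k =>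
          have hk' : k ≠ .ask := fun h => ne_ask_of_kind hk second (by rw [h])
          obtain ⟨⟨⟨i, hi, rfl⟩, -, hco⟩, -⟩ := id hc
          change k.isFinal = true → reg false = _ at hco
          rcases hi.lt_or_eq with hi | hi
          swap
          · subst hi
            rw [tapeAt_length_succ] at hcoin
            cases hcoin
          rw [tapeAt_succ_of_lt hi] at hcoin
          have hf : flips seq second k w[i] = true := by
            by_contra hf
            simp [coinPart, hf] at hcoin
          have h1 := sum_coin_mul_potential_le (ε := ε) hA hk' hi hf (reg true)
          refine le_trans (hc.2.sum_stepProb_mul_le w false (fun oc =>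
            potential seq ε (ε + (ε / 4) ^ (w.length + 1)) w
              (move seq (.run second k) (.sym w[i]) none oc).1
              ((move seq (.run second k) (.sym w[i]) none oc).2.apply (i + 1))
              ((passOp second k w[i]).1.mulVec (reg true))) _ ?_) ?_
          · intro τ hτ
            simp only [stepConfig, verifier]
            rw [tapeAt_succ_of_lt hi]
            exact le_rfl
          · simp only [verifier]
            rw [tapeAt_succ_of_lt hi]
            simp only [hcoin, Bool.false_eq_true, if_false]
            rw [hco (isFinal_of_flips hf)]
            exact h1
      -- Nothing is weighted, so the potential need only be compared along outcomes of nonzero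
      -- probability.
      · refine hc.2.sum_stepProb_mul_le_const w _ _ fun τ hτ => ?_
        exact potential_step_le hA (bound_restart_le hε0 hε1 w.length) hw (hc.2 true) hc.1
          (ne_ask_of_kind hk) (ne_halt_of_kind hk) hmain hcoin
          (outcomeProb_ne_zero_of_stepProb_ne_zero hτ true)
          (outcomeProb_ne_zero_of_stepProb_ne_zero hτ false)

/-- The configurations in which an honest prover keeps the computation. -/
def Good (w : List KGSymbol) (c : (verifier seq δ).Config) : Prop :=
  ConfigInv w c ∧ Survives seq w c.state c.head (c.reg true)

theorem haltWithin_false_verifier {w : List KGSymbol} (hw : CanWin seq w) (n : ℕ) :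
    haltWithin (keepProver Good) w false n (verifier seq δ).initial [] = 0 := by
  refine haltWithin_keepProver_false (G := Good) ?_ ?_ ?_ n [] ⟨configInv_initial w, trivial⟩
  · rintro ⟨s, j, reg⟩ hc hk
    obtain rfl : s = .halt false := eq_halt_of_kind hk
    exact Bool.noConfusion hc.2
  · rintro ⟨s, j, reg⟩ hc g hg
    have h1 := (isClosed_configInv w).com _ hc.1 g hg
    obtain ⟨second, rfl⟩ := exists_run_ask_of_kind hg
    obtain ⟨r, hr⟩ := wins_ask.1 hc.2
    exact ⟨r, h1 r, hr⟩
  · intro c hc hk τ hτ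
    refine ⟨(isClosed_configInv w).work _ hc.1 hk τ hτ, ?_⟩
    exact survives_step hw (hc.1.2 true) hc.1.1 hc.2 (ne_ask_of_kind hk) (ne_halt_of_kind hk)
      (outcomeProb_ne_zero_of_stepProb_ne_zero hτ true)
      (outcomeProb_ne_zero_of_stepProb_ne_zero hτ false)

theorem verifier_verifiesPerfectly {ε : ℚ} (hε0 : 0 < ε) (hε1 : ε ≤ 1) :
    (verifier seq (ε / 4)).VerifiesPerfectly {w | CanWin seq w} ε := by
  have hδ0 : 0 < ε / 4 := by positivity
  have hδ1 : ε / 4 ≤ 1 := by linarith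
  -- Halting is almost sure against every prover, so acceptance and rejection each control the
  -- other.
  have hsum : ∀ w P, 1 ≤ haltProb (V := verifier seq (ε / 4)) P w true + haltProb P w false :=
    fun w P => one_le_haltProb_add (isClosed_configInv w) (configInv_initial w) P
      (pow_pos hδ0 _) (pow_le_one₀ hδ0.le hδ1) (le_haltSum_verifier hδ0.le hδ1 w P)
  refine ⟨keepProver Good, fun w hw => ?_, fun w hw P => ?_⟩
  · have h1 : haltProb (V := verifier seq (ε / 4)) (keepProver Good) w false ≤ 0 :=
      haltProb_le fun n => by rw [haltWithin_false_verifier hw]; simp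
    refine le_antisymm (haltProb_le fun n => ?_) ?_
    swap
    · have := hsum w (keepProver Good)
      rw [AffineVerifier.Acc]
      linarith
    have h2 := haltWithin_true_add_false_le_one (V := verifier seq (ε / 4)) (keepProver Good) w n
      (initial _) []
    have h3 := haltWithin_nonneg (V := verifier seq (ε / 4)) (keepProver Good) w false n
      (initial _) []
    exact_mod_cast (by linarith : haltWithin (V := verifier seq (ε / 4)) (keepProver Good) w true n
      (initial _) [] ≤ 1)
  · have h1 : haltProb P w true ≤ ε :=
      haltProb_le fun n => by exact_mod_cast haltWithin_true_verifier_le hε0.le hε1 hw P n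
    have := hsum w P
    rw [Rej]
    linarith

/-! ### The words on which the prover can win -/

variable {seq second : Bool} {goal : (Fin 4 → ℚ) → Prop}

theorem wins_cons_of_next {a : KGSymbol} {l : List KGSymbol} {k k' : Ctrl} {v : Fin 4 → ℚ}
    (hk : k ≠ .ask) (hf : flips seq second k a = false)
    (hn : next seq second k a none = some k') :
    Wins seq second goal (a :: l) k v ↔
      Wins seq second goal l k' ((passOp second k a).1.mulVec v) := by
  rw [wins_cons hk, hf]
  simp [hn]

/-- The value of a binary numeral that follows digits with value `n`. -/
def valFrom (n : ℕ) (l : List Bool) : ℕ := l.foldl (fun n b => 2 * n + b.toNat) n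

/-- Horner's scheme on the negated value, so that the flush at the end of the numeral subtracts the
number. A numeral that is not chosen leaves the register alone. -/
theorem wins_digits (q : Bool) (c : Option Bool) (s d : Bool) (ds : List Bool) (l : List KGSymbol)
    (t : ℚ) (n : ℕ) :
    Wins seq second goal (ds.map .bit ++ l) (.num q c s d) (vec t (-n)) ↔
      Wins seq second goal l (.num q c s (d || !ds.isEmpty))
        (vec t (-(if c = some (!s) then valFrom n ds else n : ℕ))) := by
  induction ds generalizing d n with
  | nil => simp [valFrom]
  | cons b ds ih =>
    rw [List.map_cons, List.cons_append, wins_cons_of_next (k' := .num q c s true) (by simp) rfl rfl]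
    by_cases hc : c = some (!s)
    · simp only [passOp, if_pos hc]
      rw [opDigit_mulVec, show 2 * (-(n : ℚ)) - b.toNat = -((2 * n + b.toNat : ℕ) : ℚ) by
        push_cast; ring, ih]
      simp [hc, valFrom]
    · simp only [passOp, if_neg hc]
      rw [opId_mulVec, ih]
      simp [hc]

/-- The number that is chosen from a pair. -/
def pick (a b : List Bool) : Option Bool → ℕ
  | none => 0
  | some true => binVal a
  | some false => binVal b

theorem wins_pair (q : Bool) (c : Option Bool) {a b : List Bool} (ha : a ≠ []) (hb : b ≠ [])
    (l : List KGSymbol) (t : ℚ) :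
    Wins seq second goal ([.lpar] ++ a.map .bit ++ [.comma] ++ b.map .bit ++ [.rpar] ++ l)
        (.par q c) (vec t 0) ↔
      Wins seq second goal l (if q then .block else .exq) (vec (t - pick a b c) 0) := by
  simp only [List.append_assoc, List.cons_append, List.nil_append]
  rw [wins_cons_of_next (k' := .num q c false false) (by simp) rfl rfl]
  simp only [passOp]
  have ha' : a.isEmpty = false := by simpa using ha
  have hb' : b.isEmpty = false := by simpa using hb
  have h0 := fun t => wins_digits (seq := seq) (second := second) (goal := goal) q c false false a
    (.comma :: (b.map .bit ++ .rpar :: l)) t 0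
  have h1 := fun t => wins_digits (seq := seq) (second := second) (goal := goal) q c true false b
    (.rpar :: l) t 0
  simp only [Nat.cast_zero, neg_zero] at h0 h1
  rw [opId_mulVec, h0, ha']
  simp only [Bool.false_or, Bool.not_false]
  rw [wins_cons_of_next (k' := .num q c true false) (by simp) rfl rfl]
  simp only [passOp]
  rw [opFlush_mulVec, h1, hb']
  simp only [Bool.false_or, Bool.not_false]
  rw [wins_cons_of_next (k' := if q then .block else .exq) (by simp) rfl (by cases q <;> rfl)]
  simp only [passOp]
  rw [opFlush_mulVec]
  have : t + -((if c = some true then valFrom 0 a else 0 : ℕ) : ℚ) +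
      -((if c = some (!true) then valFrom 0 b else 0 : ℕ) : ℚ) = t - pick a b c := by
    rcases c with _ | _ | _ <;> simp [pick, binVal, valFrom, sub_eq_add_neg]
  rw [this]

/-- The game on a list of blocks, where the numbers chosen are subtracted from `t`. -/
def play (seq second : Bool) (goal : (Fin 4 → ℚ) → Prop) : List KGBlock → ℚ → Prop
  | [], t => goal (vec t 0)
  | B :: Bs, t => ∀ o : Option Bool, o.isSome = active seq second false →
      ∃ o' : Option Bool, o'.isSome = active seq second true ∧
        play seq second goal Bs (t - pick B.a B.b o - pick B.e B.f o')

/-- An inactive quantifier ranges over `none` only, which picks the number `0`; thus one statement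
covers both passes and both forms of the game. -/
theorem wins_block {k : Ctrl} (hk : k.isFinal = true) {B : KGBlock} (hB : B.WellFormed)
    (l : List KGSymbol) (t : ℚ) :
    Wins seq second goal (B.encode ++ l) k (vec t 0) ↔
      ∀ o : Option Bool, o.isSome = active seq second false →
        ∃ o' : Option Bool, o'.isSome = active seq second true ∧
          Wins seq second goal l .block (vec (t - pick B.a B.b o - pick B.e B.f o') 0) := by
  obtain ⟨ha, hb, he, hf⟩ := hB
  have hk' : k ≠ .ask := by rintro rfl; cases hk
  have hflip : flips seq second k .all = active seq second false := by
    cases k <;> first | rfl | cases hk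
  have hnext : ∀ o, next seq second k .all o = some (.par false o) := by
    intro o; cases k <;> first | rfl | cases hk
  have hop : passOp second k .all = opId := by
    cases k <;> rfl
  have hB : B.encode ++ l = .all :: ([.lpar] ++ B.a.map .bit ++ [.comma] ++ B.b.map .bit ++ [.rpar]
      ++ (.ex :: ([.lpar] ++ B.e.map .bit ++ [.comma] ++ B.f.map .bit ++ [.rpar] ++ l))) := by
    simp [KGBlock.encode]
  rw [hB, wins_cons hk', hflip, hop, opId_mulVec]
  refine forall₂_congr fun o _ => ?_
  simp only [hnext, Option.some.injEq, exists_eq_left']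
  rw [wins_pair false o ha hb]
  simp only [Bool.false_eq_true, if_false]
  rw [wins_cons_of_next (k' := if active seq second true then .ask else .par true none)
    (by simp) rfl rfl]
  simp only [passOp]
  rw [opId_mulVec]
  cases active seq second true
  · simp only [Bool.false_eq_true, if_false]
    rw [wins_pair true none he hf]
    simp
  · simp only [if_true]
    rw [wins_ask]
    simp only [wins_pair true _ he hf, if_true]
    constructor
    · rintro ⟨r, hr⟩
      exact ⟨some r, rfl, hr⟩
    · rintro ⟨o', ho', hr⟩
      obtain ⟨r, rfl⟩ := Option.isSome_iff_exists.1 ho'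
      exact ⟨r, hr⟩

theorem wins_blocks {k : Ctrl} (hk : k.isFinal = true) {Bs : List KGBlock}
    (hBs : ∀ B ∈ Bs, B.WellFormed) (t : ℚ) :
    Wins seq second goal (Bs.flatMap KGBlock.encode) k (vec t 0) ↔ play seq second goal Bs t := by
  induction Bs generalizing k t with
  | nil =>
    rw [List.flatMap_nil, wins_nil (by rintro rfl; cases hk)]
    simp [hk, play]
  | cons B Bs ih =>
    rw [List.flatMap_cons, wins_block hk (hBs B (by simp)), play]
    simp only [ih (k := .block) rfl fun B hB => hBs B (by simp [hB])]

theorem wins_sum_first {s : List Bool} {Bs : List KGBlock}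
    (hBs : ∀ B ∈ Bs, B.WellFormed) (n : ℕ) :
    Wins seq false goal (kgEncode s Bs) .sum (vec n 0) ↔
      play seq false goal Bs (valFrom n s) := by
  induction s generalizing n with
  | nil => exact wins_blocks rfl hBs _
  | cons b s ih =>
    have := ih (2 * n + b.toNat)
    simp only [kgEncode] at this ⊢
    rw [List.map_cons, List.cons_append, wins_cons_of_next (k' := .sum) (by simp) rfl rfl]
    simp only [passOp, Bool.false_eq_true, if_false]
    rw [opSum_mulVec, ← Nat.cast_two, ← Nat.cast_mul, ← Nat.cast_add, this]
    rfl

theorem wins_sum_second {s : List Bool} {Bs : List KGBlock}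
    (hBs : ∀ B ∈ Bs, B.WellFormed) (t : ℚ) :
    Wins seq true goal (kgEncode s Bs) .sum (vec t 0) ↔ play seq true goal Bs t := by
  induction s with
  | nil => exact wins_blocks rfl hBs _
  | cons b s ih =>
    simp only [kgEncode] at ih ⊢
    rw [List.map_cons, List.cons_append, wins_cons_of_next (k' := .sum) (by simp) rfl rfl]
    simp only [passOp, if_true]
    rw [opId_mulVec, ih]

theorem wins_start_first {s : List Bool} (hs : s ≠ []) {Bs : List KGBlock}
    (hBs : ∀ B ∈ Bs, B.WellFormed) :
    Wins seq false goal (kgEncode s Bs) .start (vec 0 0) ↔ play seq false goal Bs (binVal s) := by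
  have := wins_sum_first (seq := seq) (goal := goal) (s := s) hBs 0
  rw [binVal, ← valFrom, ← this]
  cases s with
  | nil => exact absurd rfl hs
  | cons b s =>
    simp only [kgEncode, List.map_cons, List.cons_append]
    -- The states `start` and `sum` treat a first digit alike; `start` only rules out the empty
    -- numeral.
    rw [wins_cons_of_next (k' := .sum) (by simp) rfl rfl,
      wins_cons_of_next (k' := .sum) (by simp) rfl rfl]
    simp [passOp]

theorem wins_start_second {s : List Bool} (hs : s ≠ []) {Bs : List KGBlock}
    (hBs : ∀ B ∈ Bs, B.WellFormed) (t : ℚ) :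
    Wins seq true goal (kgEncode s Bs) .start (vec t 0) ↔ play seq true goal Bs t := by
  rw [← wins_sum_second (s := s) hBs]
  cases s with
  | nil => exact absurd rfl hs
  | cons b s =>
    simp only [kgEncode, List.map_cons, List.cons_append]
    rw [wins_cons_of_next (k' := .sum) (by simp) rfl rfl,
      wins_cons_of_next (k' := .sum) (by simp) rfl rfl]
    simp [passOp]

theorem canWin_kgEncode {s : List Bool} (hs : s ≠ []) {Bs : List KGBlock}
    (hBs : ∀ B ∈ Bs, B.WellFormed) :
    CanWin seq (kgEncode s Bs) ↔
      play seq false (Wins seq true (· = vec 0 0) (kgEncode s Bs) .start) Bs (binVal s) := by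
  rw [CanWin, wins_start_first hs hBs]
  rfl

theorem isSome_eq_true_iff_exists {p : Option Bool → Prop} :
    (∃ o : Option Bool, o.isSome = true ∧ p o) ↔ p (some true) ∨ p (some false) := by
  simp [Option.exists, or_comm]

theorem isSome_eq_true_iff_forall {p : Option Bool → Prop} :
    (∀ o : Option Bool, o.isSome = true → p o) ↔ p (some true) ∧ p (some false) := by
  simp [Option.forall, and_comm]

theorem isSome_eq_false_iff_exists {p : Option Bool → Prop} :
    (∃ o : Option Bool, o.isSome = false ∧ p o) ↔ p none := by
  simp

theorem isSome_eq_false_iff_forall {p : Option Bool → Prop} :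
    (∀ o : Option Bool, o.isSome = false → p o) ↔ p none := by
  simp

/-! ### The order of the quantifiers in the two forms of the game -/

/-- No choice is active here: the first pass merely reads `S` and checks the form of the word. -/
theorem play_false_first (Bs : List KGBlock) (t : ℚ) :
    play false false goal Bs t ↔ goal (vec t 0) := by
  induction Bs generalizing t with
  | nil => rfl
  | cons B Bs ih =>
    simp [play, active, ih, pick]

theorem play_false_second (S : ℕ) (Bs : List KGBlock) (t : ℕ) :
    play false true (· = vec 0 0) Bs ((S : ℚ) - t) ↔ kgAlternatingFrom S t Bs := by
  induction Bs generalizing t with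
  | nil =>
    simp only [play, kgAlternatingFrom]
    constructor
    · intro h
      have := (vec_injective h).1
      rw [sub_eq_zero] at this
      exact_mod_cast this
    · rintro rfl
      simp
  | cons B Bs ih =>
    have h : ∀ x y : ℕ, (S : ℚ) - t - x - y = (S : ℚ) - (t + (x + y) : ℕ) := fun x y => by
      push_cast; ring
    simp only [play, active, if_true, Bool.false_or, Bool.not_false, Bool.true_or,
      isSome_eq_true_iff_exists, isSome_eq_true_iff_forall, kgAlternatingFrom, pick, h, ih]
    simp

/-- No reply comes between the tosses, so the successive universal quantifiers merge into one over
the whole sequence. -/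
theorem play_true_first (Bs : List KGBlock) (t : ℚ) :
    play true false goal Bs t ↔ ∀ x : Fin Bs.length → ℕ,
      (∀ i, x i ∈ ({binVal (Bs.get i).a, binVal (Bs.get i).b} : Set ℕ)) →
        goal (vec (t - (∑ i, x i : ℕ)) 0) := by
  induction Bs generalizing t with
  | nil => simp [play]
  | cons B Bs ih =>
    simp only [List.length_cons]
    rw [Fin.forall_fin_succ_pi]
    simp only [play, active, Bool.not_true, Bool.false_eq_true, if_false,
      Bool.not_false, Bool.and_true, isSome_eq_true_iff_forall, isSome_eq_false_iff_exists, ih]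
    simp only [Fin.forall_fin_succ, Fin.sum_univ_succ, pick, sub_sub, Nat.cast_zero, add_zero,
      Nat.cast_add, Fin.cons_zero, Fin.cons_succ]
    constructor
    · rintro ⟨h1, h2⟩ _ x ⟨rfl | rfl, hx⟩
      exacts [h1 x hx, h2 x hx]
    · intro h
      exact ⟨fun x hx => h _ x ⟨.inl rfl, hx⟩, fun x hx => h _ x ⟨.inr rfl, hx⟩⟩

/-- No toss comes between the replies, so the prover in effect chooses the whole sequence `y` at
once. -/
theorem play_true_second (Bs : List KGBlock) (t : ℚ) :
    play true true goal Bs t ↔ ∃ y : Fin Bs.length → ℕ,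
      (∀ i, y i ∈ ({binVal (Bs.get i).e, binVal (Bs.get i).f} : Set ℕ)) ∧
        goal (vec (t - (∑ i, y i : ℕ)) 0) := by
  induction Bs generalizing t with
  | nil => simp [play]
  | cons B Bs ih =>
    simp only [List.length_cons]
    rw [Fin.exists_fin_succ_pi]
    simp only [play, active, Bool.not_true, Bool.or_false, if_true,
      isSome_eq_true_iff_exists, isSome_eq_false_iff_forall, ih]
    simp only [Fin.forall_fin_succ, Fin.sum_univ_succ, pick, sub_sub, Nat.cast_zero, zero_add,
      Nat.cast_add, Fin.cons_zero, Fin.cons_succ]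
    constructor
    · rintro (⟨y, hy, hg⟩ | ⟨y, hy, hg⟩)
      exacts [⟨_, y, ⟨.inl rfl, hy⟩, hg⟩, ⟨_, y, ⟨.inr rfl, hy⟩, hg⟩]
    · rintro ⟨_, y, ⟨rfl | rfl, hy⟩, hg⟩
      exacts [.inl ⟨y, hy, hg⟩, .inr ⟨y, hy, hg⟩]

theorem canWin_false_kgEncode {s : List Bool} (hs : s ≠ []) {Bs : List KGBlock}
    (hBs : ∀ B ∈ Bs, B.WellFormed) :
    CanWin false (kgEncode s Bs) ↔ kgAlternating (binVal s) Bs := by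
  rw [canWin_kgEncode hs hBs, play_false_first, wins_start_second hs hBs, kgAlternating,
    ← play_false_second, Nat.cast_zero, sub_zero]

theorem canWin_true_kgEncode {s : List Bool} (hs : s ≠ []) {Bs : List KGBlock}
    (hBs : ∀ B ∈ Bs, B.WellFormed) :
    CanWin true (kgEncode s Bs) ↔ kgSequential (binVal s) Bs := by
  rw [canWin_kgEncode hs hBs, play_true_first, kgSequential]
  refine forall₂_congr fun x _ => ?_
  rw [wins_start_second hs hBs, play_true_second]
  refine exists_congr fun y => and_congr_right fun _ => ?_
  rw [Finset.sum_add_distrib]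
  constructor
  · intro h
    have := (vec_injective h).1
    rw [sub_sub, sub_eq_zero] at this
    exact_mod_cast this
  · intro h
    rw [h]
    push_cast
    simp

/-! ### The form of the words -/

/-- A sequence of well-formed blocks. -/
def IsBlocks (l : List KGSymbol) : Prop :=
  ∃ Bs : List KGBlock, (∀ B ∈ Bs, B.WellFormed) ∧ l = Bs.flatMap KGBlock.encode

/-- Digits, a given symbol and a word of the form `R`. Unless `d` holds, there is at least one
digit. -/
def IsDigits (a : KGSymbol) (R : List KGSymbol → Prop) (d : Bool) (l : List KGSymbol) : Prop :=
  ∃ ds l', (d = true ∨ ds ≠ []) ∧ l = ds.map .bit ++ a :: l' ∧ R l'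

/-- A pair of numbers and a word of the form `R`. -/
def IsPair (R : List KGSymbol → Prop) (l : List KGSymbol) : Prop :=
  ∃ l', l = .lpar :: l' ∧ IsDigits .comma (IsDigits .rpar R false) false l'

/-- The remainder of a well-formed word after the first half of a block. -/
def IsExists (l : List KGSymbol) : Prop := ∃ l', l = .ex :: l' ∧ IsPair IsBlocks l'

/-- The form of a word that makes a pass succeed from a given state. -/
def HasForm : Ctrl → List KGSymbol → Prop
  | .start, l => ∃ (s : List Bool) (l' : List KGSymbol), s ≠ [] ∧ l = s.map .bit ++ l' ∧ IsBlocks l'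
  | .sum, l => ∃ (s : List Bool) (l' : List KGSymbol), l = s.map .bit ++ l' ∧ IsBlocks l'
  | .block, l => IsBlocks l
  | .par q _, l => IsPair (if q then IsBlocks else IsExists) l
  | .num q _ false d, l =>
      IsDigits .comma (IsDigits .rpar (if q then IsBlocks else IsExists) false) d l
  | .num q _ true d, l => IsDigits .rpar (if q then IsBlocks else IsExists) d l
  | .exq, l => IsExists l
  | .ask, l => IsPair IsBlocks l

theorem IsDigits.cons {a : KGSymbol} {R : List KGSymbol → Prop} {l : List KGSymbol}
    (h : IsDigits a R true l) (b d : Bool) : IsDigits a R d (.bit b :: l) := by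
  obtain ⟨ds, l', -, rfl, hR⟩ := h
  exact ⟨b :: ds, l', .inr (by simp), rfl, hR⟩

theorem IsPair.isBlocks {l : List KGSymbol} (h : IsPair IsExists l) : IsBlocks (.all :: l) := by
  obtain ⟨_, rfl, a, _, ha, rfl, b, _, hb, rfl, _, rfl, _, rfl, e, _, he, rfl, f, _, hf, rfl,
    Bs, hBs, rfl⟩ := h
  refine ⟨⟨a, b, e, f⟩ :: Bs, ?_, by simp [KGBlock.encode]⟩
  rw [List.forall_mem_cons]
  refine ⟨?_, hBs⟩
  simp only [Bool.false_eq_true, false_or] at ha hb he hf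
  exact ⟨ha, hb, he, hf⟩

theorem hasForm_nil {k : Ctrl} (hk : k.isFinal = true) : HasForm k [] := by
  have h : IsBlocks [] := ⟨[], by simp, rfl⟩
  cases k with
  | sum => exact ⟨[], [], rfl, h⟩
  | block => exact h
  | _ => cases hk

theorem hasForm_cons {k k' : Ctrl} {a : KGSymbol} {o : Option Bool} {l : List KGSymbol}
    (hn : next seq second k a o = some k') (h : HasForm k' l) : HasForm k (a :: l) := by
  cases k with
  | start =>
    cases a with
    | bit b =>
      cases hn
      obtain ⟨s, l', rfl, hl'⟩ := h
      exact ⟨b :: s, l', by simp, rfl, hl'⟩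
    | _ => cases hn
  | sum =>
    cases a with
    | bit b =>
      cases hn
      obtain ⟨s, l', rfl, hl'⟩ := h
      exact ⟨b :: s, l', rfl, hl'⟩
    | all =>
      cases hn
      exact ⟨[], _, rfl, IsPair.isBlocks h⟩
    | _ => cases hn
  | block =>
    cases a with
    | all =>
      cases hn
      exact IsPair.isBlocks h
    | _ => cases hn
  | par q c =>
    cases a with
    | lpar =>
      cases hn
      exact ⟨l, rfl, h⟩
    | _ => cases hn
  | num q c s d =>
    cases a with
    | bit b =>
      cases hn
      cases s <;> exact IsDigits.cons h b d
    | comma =>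
      cases s <;> cases d <;> cases hn
      exact ⟨[], l, .inl rfl, rfl, h⟩
    | rpar =>
      cases q <;> cases s <;> cases d <;> cases hn <;> exact ⟨[], l, .inl rfl, rfl, h⟩
    | _ => cases hn
  | exq =>
    cases a with
    | ex =>
      refine ⟨l, rfl, ?_⟩
      simp only [next, Option.some.injEq] at hn
      subst hn
      split_ifs at h
      · exact h
      · exact h
    | _ => cases hn
  | ask => cases hn

/-- A winning position has at least one complete run, and the form of a word can be read off from
any such run. -/
theorem hasForm_of_wins {l : List KGSymbol} {k : Ctrl} {v : Fin 4 → ℚ}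
    (h : Wins seq second goal l k v) : HasForm k l := by
  induction l generalizing k v with
  | nil =>
    by_cases hk : k = .ask
    · subst hk
      obtain ⟨r, hr⟩ := wins_ask.1 h
      rw [wins_nil (by simp)] at hr
      cases hr.1
    · exact hasForm_nil ((wins_nil hk).1 h).1
  | cons a l ih =>
    have key : ∀ {k : Ctrl}, k ≠ .ask → Wins seq second goal (a :: l) k v → HasForm k (a :: l) := by
      intro k hk h
      rw [wins_cons hk] at h
      -- One side of the coin is enough, as the form does not depend on the choices.
      obtain ⟨k', hn, hw⟩ := h (if flips seq second k a then some true else none)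
        (by cases flips seq second k a <;> rfl)
      exact hasForm_cons hn (ih hw)
    by_cases hk : k = .ask
    · subst hk
      obtain ⟨r, hr⟩ := wins_ask.1 h
      exact key (k := .par true (some r)) (by simp) hr
    · exact key hk h

theorem setOf_canWin_eq {win : ℕ → List KGBlock → Prop}
    (h : ∀ (s : List Bool) (Bs : List KGBlock), s ≠ [] → (∀ B ∈ Bs, B.WellFormed) →
      (CanWin seq (kgEncode s Bs) ↔ win (binVal s) Bs)) :
    {w | CanWin seq w} = kgLanguage win := by
  ext w
  constructor
  · intro hw
    obtain ⟨s, _, hs, rfl, Bs, hBs, rfl⟩ := hasForm_of_wins (k := .start) hw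
    exact ⟨s, Bs, hs, hBs, rfl, (h s Bs hs hBs).1 hw⟩
  · rintro ⟨s, Bs, hs, hBs, rfl, hwin⟩
    exact (h s Bs hs hBs).2 hwin

end KnapsackVerifier

theorem AffineVerifier.VerifiesPerfectly.mono {α : Type} {V : AffineVerifier α} {L : Set (List α)}
    {ε ε' : ℝ} (h : V.VerifiesPerfectly L ε) (hε : ε ≤ ε') : V.VerifiesPerfectly L ε' := by
  obtain ⟨P, h1, h2⟩ := h
  exact ⟨P, h1, fun w hw P' => le_trans (by linarith) (h2 w hw P')⟩

open KnapsackVerifier in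
theorem mainTheorem4 (ε : ℝ) (hε₀ : 0 < ε) (hε₁ : ε < 1 / 2) :
    (∃ V : AffineVerifier KGSymbol, V.VerifiesPerfectly (kgLanguage kgAlternating) ε) ∧
    (∃ V : AffineVerifier KGSymbol, V.VerifiesPerfectly (kgLanguage kgSequential) ε) := by
  -- The operators have rational entries, so the error is first lowered to a rational number.
  obtain ⟨q, hq0, hqε⟩ := exists_rat_btwn hε₀
  have hq0' : 0 < q := by exact_mod_cast hq0
  have hq1 : q ≤ 1 := by
    have : (q : ℝ) < 1 := by linarith
    exact_mod_cast this.le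
  refine ⟨⟨verifier false (q / 4), ?_⟩, ⟨verifier true (q / 4), ?_⟩⟩
  · rw [← setOf_canWin_eq fun s Bs hs hBs => canWin_false_kgEncode hs hBs]
    exact (verifier_verifiesPerfectly hq0' hq1).mono hqε.le
  · rw [← setOf_canWin_eq fun s Bs hs hBs => canWin_true_kgEncode hs hBs]
    exact (verifier_verifiesPerfectly hq0' hq1).mono hqε.le
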